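/- Let $\xi$ be a real analytic vector field on an open neighbourhood $U$ of $0$ in $\mathbb{R}^3$ with $\xi(0)=0$. *Trajectories.* An integral curve of $\xi$ at $0$ is a $C^1$ curve $c:(0,a)\to U\setminus\{0\}$, $a>0$, with $\lim_{t\to0^+}c(t)=0$, $\xi(c(t))\neq 0$ and $\xi(c(t))\wedge c'(t)=0$ for all $t$. A trajectory is the image of an integral curve. (The vector fields $\xi$ and $-\xi$ have the same trajectories.) *Pencils.* A formal curve at $0$ is given by a parameterization $\mathcal C(t)\in(t\mathbb{R}[[t]])^3\setminus\{0\}$. Its half-branch $\mathcal C^+$ ($t>0$) has a sequence of oriented iterated tangents $(p_n)_{n\ge0}$: $p_0=0$, $\mathcal C_0=\mathcal C$, and $\mathcal C_{n+1}$ is the strict transform (for $t>0$) of $\mathcal C_n$ by the spherical blow-up $\rho_n$ centred at $p_n$, $p_{n+1}=\mathcal C_{n+1}(0)$. A trajectory $\Gamma$ has iterated oriented tangents $(q_n)_{n\ge0}$ if $q_0=0$, $\Gamma_0=\Gamma$ and, for all $n$, $q_{n+1}$ is the unique accumulation point of $\Gamma_{n+1}:=\rho_n^{-1}(\Gamma_n)$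 in $\rho_n^{-1}(q_n)$, where $\rho_n$ is the spherical blow-up at $q_n$. The integral pencil $\mathcal P_{\mathcal C^+}$ of $\xi$ with axis $\mathcal C^+$ is the set of all trajectories of $\xi$ that have iterated oriented tangents and for which this sequence equals that of $\mathcal C^+$. The axis is non-degenerate if $\mathcal C$ is not contained in the singular locus of $\xi$, i.e. $\xi(\mathcal C(t))\neq0$ as a formal vector. *Flat contact.* A chart $B=(V,(x,y_1,y_2))$ at $0$ consists of an open set $V$ with $0\in\overline V$ and a $C^1$ diffeomorphism $(x,y_1,y_2)$ from $V$ onto its image that tends to $0$ at $0$, both definable in the structure $\mathbb{R}_{\mathrm{an}}$ of globally subanalytic sets. It is an analytic chart at the origin if moreover $0\in V$ and $(x,y_1,y_2)$ is real analytic on $V$. The chart is adapted to a trajectory $\Gamma$ of $\xi$ if $V$ contains a representative of the germ of $\Gamma$ at $0$ on which $dx(\xi)>0$. We say that $\Gamma,\Delta$ have flat contact in $B$, with respect to $\xi$, if $B$ is adapted to both, the germs at $0$ of $\Gamma$ and $\Delta$ have parameterizations $c,d$ by $x\in(0,a)$ (integral curves in $V$ with $x(c(t))=t=x(d(t))$),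 and the maps $\gamma_B=(y_1,y_2)\circ c$ and $\delta_B=(y_1,y_2)\circ d$ satisfy: for every $k\in\mathbb{N}$ there is $a_k>0$ with $\|\delta_B(x)-\gamma_B(x)\|\le x^k$ for all $x\in(0,a_k)$. **Statement.** Let $\mathcal P_{\mathcal C^+}$ be an integral pencil of $\xi$ with a formal non-degenerate axis, and let $\Gamma,\Delta\in\mathcal P_{\mathcal C^+}$. Then there is an analytic chart $B$ at the origin such that $\Gamma$ and $\Delta$ have flat contact in $B$, with respect to $\xi$ or with respect to $-\xi$ (the latter when the trajectories are oriented by $\xi$ towards $0$). -/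

import Mathlib

open Set Filter Topology

noncomputable section

namespace FlatContactPencil

/-- The Euclidean space `ℝ³`. -/
abbrev R3 : Type := EuclideanSpace ℝ (Fin 3)

/-! ### Sets definable in the structure of restricted analytic functions -/

/-- Function symbols of the language of the real field with restricted analytic functions: addition,
multiplication, and one `n`-ary symbol for every function `g` that is real analytic on a
neighbourhood of the cube `[-1,1]ⁿ`. -/
inductive AnFunctions : ℕ → Type
  | add : AnFunctions 2
  | mul : AnFunctions 2
  | restricted {n : ℕ} (g : (Fin n → ℝ) → ℝ)
      (hg : AnalyticOnNhd ℝ g (Icc (fun _ => (-1 : ℝ)) (fun _ => (1 : ℝ)))) : AnFunctions n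

/-- The language of `ℝ_an` (the order of `ℝ` is definable from the field operations). -/
def anLanguage : FirstOrder.Language := ⟨AnFunctions, fun _ => Empty⟩

open Classical in
/-- The structure `ℝ_an` on the reals. The symbol of `g` is interpreted by the function equal to
`g` on `[-1,1]ⁿ` and to `0` outside. -/
instance anStructure : anLanguage.Structure ℝ where
  funMap := fun f x =>
    match f, x with
    | AnFunctions.add, x => x 0 + x 1
    | AnFunctions.mul, x => x 0 * x 1
    | AnFunctions.restricted g _, x =>
        if x ∈ Icc (fun _ => (-1 : ℝ)) (fun _ => (1 : ℝ)) then g x else 0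
  RelMap := fun r _ => Empty.elim r

/-- Definability in `ℝ_an` with arbitrary real parameters (that is, being globally
subanalytic). -/
def AnDefinable {α : Type} (s : Set (α → ℝ)) : Prop :=
  (Set.univ : Set ℝ).Definable anLanguage s

/-! ### Trajectories -/

/-- Two subsets of `ℝ³` have the same germ at `0`. -/
def SameGerm (A B : Set R3) : Prop := ∀ᶠ p in 𝓝 (0 : R3), p ∈ A ↔ p ∈ B

/-- `c : (0,a) → ℝ³ ∖ {0}` is an integral curve at `0` of the vector field `ξ` defined on `U`: a
`C¹` curve in `U` which tends to `0` at `0⁺`, along which `ξ` does not vanish and to which `ξ` is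
tangent (for `ξ (c t) ≠ 0`, the condition `ξ (c t) ∧ c' t = 0` says that `c' t` is a multiple of
`ξ (c t)`). -/
structure IsIntegralCurve (U : Set R3) (ξ : R3 → R3) (a : ℝ) (c : ℝ → R3) : Prop where
  pos : 0 < a
  contDiffOn : ContDiffOn ℝ 1 c (Ioo 0 a)
  mem : ∀ t ∈ Ioo 0 a, c t ∈ U
  ne_zero : ∀ t ∈ Ioo 0 a, c t ≠ 0
  tendsto : Tendsto c (𝓝[>] 0) (𝓝 0)
  field_ne_zero : ∀ t ∈ Ioo 0 a, ξ (c t) ≠ 0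
  tangent : ∀ t ∈ Ioo 0 a, ∃ l : ℝ, deriv c t = l • ξ (c t)

/-- A trajectory at `0` of `ξ` is the image of an integral curve. -/
def IsTrajectory (U : Set R3) (ξ : R3 → R3) (Γ : Set R3) : Prop :=
  ∃ (a : ℝ) (c : ℝ → R3), IsIntegralCurve U ξ a c ∧ Γ = c '' Ioo 0 a

/-! ### Charts and flat contact -/

/-- A chart at `0`, definable in `ℝ_an`: an open definable set `V` with `0` in its closure and a
definable `C¹` diffeomorphism `X` of `V` onto its image which tends to `0` at `0`. Only the values
of `X` on `V` matter. -/
structure Chart where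
  V : Set R3
  X : R3 → R3
  isOpen : IsOpen V
  zero_mem_closure : (0 : R3) ∈ closure V
  definable_domain : AnDefinable {v : Fin 3 → ℝ | WithLp.toLp 2 v ∈ V}
  definable_map : AnDefinable {w : Fin 3 ⊕ Fin 3 → ℝ |
    WithLp.toLp 2 (w ∘ Sum.inl) ∈ V ∧
      X (WithLp.toLp 2 (w ∘ Sum.inl)) = WithLp.toLp 2 (w ∘ Sum.inr)}
  contDiffOn : ContDiffOn ℝ 1 X V
  injOn : InjOn X V
  bijective_fderiv : ∀ p ∈ V, Function.Bijective (fderiv ℝ X p)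
  tendsto : Tendsto X (𝓝[V] 0) (𝓝 0)

namespace Chart

/-- The chart is an analytic chart at the origin: `V` is a neighbourhood of `0` and `X` is real
analytic on `V`. -/
def IsAnalytic (C : Chart) : Prop := (0 : R3) ∈ C.V ∧ AnalyticOnNhd ℝ C.X C.V

/-- The chart `(V, (x, y₁, y₂))` is adapted to `Γ`: `V` contains a representative of the germ of `Γ`
at `0` on which `dx(ξ)` is positive. -/
def IsAdapted (C : Chart) (ξ : R3 → R3) (Γ : Set R3) : Prop :=
  ∃ Γ' : Set R3, SameGerm Γ' Γ ∧ Γ' ⊆ C.V ∧ ∀ p ∈ Γ', 0 < (fderiv ℝ C.X p (ξ p)) 0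

/-- `c : (0,a) → V` is the parameterization of (the germ at `0` of) `Γ` by the first coordinate `x`
of the chart: `x (c t) = t`. -/
def IsParameterization (C : Chart) (U : Set R3) (ξ : R3 → R3) (Γ : Set R3)
    (a : ℝ) (c : ℝ → R3) : Prop :=
  IsIntegralCurve U ξ a c ∧ (∀ t ∈ Ioo 0 a, c t ∈ C.V ∧ C.X (c t) 0 = t) ∧
    SameGerm (c '' Ioo 0 a) Γ

/-- The curve `x ↦ (y₁ (c x), y₂ (c x))`. -/
def graphMap (C : Chart) (c : ℝ → R3) (x : ℝ) : EuclideanSpace ℝ (Fin 2) :=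
  !₂[C.X (c x) 1, C.X (c x) 2]

end Chart

/-- Flat contact at `0⁺` of two curves `γ, δ` in the plane. -/
def FlatCurves (γ δ : ℝ → EuclideanSpace ℝ (Fin 2)) : Prop :=
  ∀ k : ℕ, ∃ a > 0, ∀ x ∈ Ioo (0 : ℝ) a, ‖δ x - γ x‖ ≤ x ^ k

/-- `Γ` and `Δ` have flat contact in the chart `C`: the chart is adapted to both, and the curves
`γ_C`, `δ_C` that describe them as graphs over `x > 0` have flat contact. -/
def FlatContactIn (C : Chart) (U : Set R3) (ξ : R3 → R3) (Γ Δ : Set R3) : Prop :=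
  C.IsAdapted ξ Γ ∧ C.IsAdapted ξ Δ ∧
    ∃ (a b : ℝ) (c d : ℝ → R3),
      C.IsParameterization U ξ Γ a c ∧ C.IsParameterization U ξ Δ b d ∧
        FlatCurves (C.graphMap c) (C.graphMap d)

/-! ### Iterated spherical blow-ups

The spherical blow-up of a Euclidean space `E` at `q` is realized as
`{(p, w) ∈ E × E : ‖w‖ = 1, p - q = ‖p - q‖ w}` with the projection `(p, w) ↦ p`: over `p ≠ q` there
is one point, and over `q` the unit sphere. The spherical blow-up at `q` of a submanifold (with
boundary or corners) `M ⊆ E`, is the closure in this space of the inverse image of `M ∖ {q}`. Hence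
the `n`-fold blow-up of `ℝ³` lives in the Euclidean space `Tower n`, where `Tower 0 = ℝ³` and
`Tower (n+1) = Tower n × Tower n`. -/

/-- Index set of the coordinates of the `n`-th ambient space. -/
def TowerIdx : ℕ → Type
  | 0 => Fin 3
  | n + 1 => TowerIdx n ⊕ TowerIdx n

instance instFintypeTowerIdx : (n : ℕ) → Fintype (TowerIdx n)
  | 0 => inferInstanceAs (Fintype (Fin 3))
  | n + 1 =>
    letI := instFintypeTowerIdx n
    inferInstanceAs (Fintype (TowerIdx n ⊕ TowerIdx n))

/-- The Euclidean space that contains the `n`-fold blow-up of `ℝ³`. -/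
abbrev Tower (n : ℕ) : Type := EuclideanSpace ℝ (TowerIdx n)

/-- First component (the blow-down map). -/
def base {n : ℕ} (m : Tower (n + 1)) : Tower n :=
  WithLp.toLp 2 fun i => m (Sum.inl i : TowerIdx n ⊕ TowerIdx n)

/-- Second component (the oriented direction). -/
def direction {n : ℕ} (m : Tower (n + 1)) : Tower n :=
  WithLp.toLp 2 fun i => m (Sum.inr i : TowerIdx n ⊕ TowerIdx n)

/-- The spherical blow-up at `q`. -/
def sphericalBlowUp {n : ℕ} (q : Tower n) : Set (Tower (n + 1)) :=
  {m | ‖direction m‖ = 1 ∧ base m - q = ‖base m - q‖ • direction m}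

/-- The successive inverse images `Γ₀ = Γ`, `Γ_{j+1} = ρ_j⁻¹(Γ_j)`, where `ρ_j` is the spherical
blow-up at `q_j`. -/
def liftSet (Γ : Set R3) (q : (n : ℕ) → Tower n) : (n : ℕ) → Set (Tower n)
  | 0 => Γ
  | n + 1 => {m | m ∈ sphericalBlowUp (q n) ∧ base m ∈ liftSet Γ q n}

/-- `Γ` has iterated oriented tangents, and `q` is their sequence: `q₀ = 0`, and `q_{j+1}` is the
unique accumulation point of `Γ_{j+1}` in the fibre `ρ_j⁻¹(q_j)`. -/
def HasIteratedTangents (Γ : Set R3) (q : (n : ℕ) → Tower n) : Prop :=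
  q 0 = 0 ∧ ∀ (n : ℕ) (m : Tower (n + 1)),
    (m ∈ sphericalBlowUp (q n) ∧ base m = q n ∧ AccPt m (𝓟 (liftSet Γ q (n + 1)))) ↔ m = q (n + 1)

/-! ### Formal curves and their half-branches -/

/-- A parameterization of a formal curve at the origin of `ℝ³`: a nonzero triple of formal power
series in `t` without constant terms. -/
structure FormalCurve where
  toFun : Fin 3 → PowerSeries ℝ
  constantCoeff_eq_zero : ∀ i, PowerSeries.constantCoeff (toFun i) = 0
  ne_zero : toFun ≠ 0

/-- A formal series in `t` that is positive for `t > 0`: its first nonzero coefficient is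
positive. -/
def SeriesPos (l : PowerSeries ℝ) : Prop :=
  ∃ m : ℕ, (∀ k < m, PowerSeries.coeff k l = 0) ∧ 0 < PowerSeries.coeff m l

/-- The formal curve `D` in the blow-up is the strict transform (oriented by `t > 0`) of the formal
curve `C` by the spherical blow-up centred at `C(0)`: `D = (C, w)` with `C - C(0) = l w`, where
`w` is a formal unit vector and the series `l`, which is the norm of `C - C(0)`, is positive. -/
def IsStrictTransform {n : ℕ} (C : TowerIdx n → PowerSeries ℝ)
    (D : TowerIdx (n + 1) → PowerSeries ℝ) : Prop :=
  ∃ (l : PowerSeries ℝ) (w : TowerIdx n → PowerSeries ℝ),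
    SeriesPos l ∧ ∑ i, w i ^ 2 = 1 ∧
    (∀ i, C i - PowerSeries.C (PowerSeries.constantCoeff (C i)) = l * w i) ∧
    D = Sum.elim C w

/-- `p` is the sequence of oriented iterated tangents of the half-branch `t > 0` of the formal
curve `C`: `p_n` is the origin `C_n(0)` of the `n`-th iterated strict transform `C_n`. (The
half-branch `t < 0` is the half-branch `t > 0` of the parameterization `C(-t)`.) -/
def IsHalfBranch (C : FormalCurve) (p : (n : ℕ) → Tower n) : Prop :=
  ∃ D : (n : ℕ) → TowerIdx n → PowerSeries ℝ,
    D 0 = C.toFun ∧ (∀ n, IsStrictTransform (D n) (D (n + 1))) ∧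
    ∀ n, p n = WithLp.toLp 2 fun i => PowerSeries.constantCoeff (D n i)

/-- The integral pencil of `ξ` with axis the half-branch `t > 0` of `C`: the trajectories of `ξ`
that have iterated oriented tangents, equal to those of the half-branch. -/
def integralPencil (U : Set R3) (ξ : R3 → R3) (C : FormalCurve) : Set (Set R3) :=
  {Γ | IsTrajectory U ξ Γ ∧ ∃ p, IsHalfBranch C p ∧ HasIteratedTangents Γ p}

/-- The polynomial curve obtained by truncating `C(t)` after the terms of degree `k`. -/
def FormalCurve.jet (C : FormalCurve) (k : ℕ) (t : ℝ) : R3 :=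
  WithLp.toLp 2 fun i => (PowerSeries.trunc (k + 1) (C.toFun i)).eval t

/-- The formal power series `f(C(t))`, for `f` analytic at `0`. Its coefficient of degree `k`
depends only on the `k`-jet of `C`, so it is the `k`-th Taylor coefficient at `0` of the function
`t ↦ f (J_k C (t))`. -/
def FormalCurve.comp (f : R3 → ℝ) (C : FormalCurve) : PowerSeries ℝ :=
  PowerSeries.mk fun k => iteratedDeriv k (fun t => f (C.jet k t)) 0 / (k.factorial : ℝ)

/-- The axis is non-degenerate: `C` is not contained in the singular locus `{ξ = 0}`, that is, the
formal vector `ξ(C(t))` is not zero. -/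
def IsNonDegenerate (ξ : R3 → R3) (C : FormalCurve) : Prop :=
  ∃ i : Fin 3, FormalCurve.comp (fun p => ξ p i) C ≠ 0

end FlatContactPencil

end

/-! The two trajectories and the formal axis have the same asymptotic expansion in a small
parameter, with coefficients read off from the iterated tangents alone. Along the axis, the order of
the distance to the blown-up centre never increases from one stage to the next, so it is constant
from some stage `n` on. Hence one coordinate `i` of the `n`-th tower stays comparable to that
distance at all later stages. Let `u` be this coordinate, centred and multiplied by the constant `κ`
that makes it positive along trajectories. Every centred coordinate at stage `n + k` is `u` times a
ratio of directions, and the directions are coordinates of the next stage. Induction on the order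
therefore expands all coordinates in powers of `u`, with polynomials `A` depending only on the
tangents (`StableTower.exists_polynomial`). The argument is run in an abstract filtered ring, so
that it applies to power series modulo `X ^ N` and to functions on a trajectory modulo `O(u ^ N)`
(`exists_expansion`).

An analytic function is then either flat along `A` or equivalent to some `c * u ^ m` on every
trajectory of the pencil (`exists_tendsto_of_not_isFlat`). As the axis is not zero, some coordinate
satisfies `p i ~ σ * u ^ ν`; by non-degeneracy, some component satisfies `ξ j ~ κ * u ^ m`. The
component `ξ i` is not flat either: otherwise `|dx| ≤ x |dy|` along the trajectory, with `x = σ * p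
i` and `y = κ * p j`, so `log x` would vary no more than the bounded monotone function `y`, although
`x` tends to `0` (`IsIntegralCurve.not_slow`).

So `x` is strictly monotone along the flow, with the same sense on both trajectories, and each germ
is a graph over `x` (`IsIntegralCurve.exists_parameterization`). The chart merely permutes the
coordinates and rescales one. At equal `x`, the relation `x ~ σ ^ 2 * u ^ ν` and its full expansion
force the two parameters to agree to every order, hence also all coordinates
(`isBigO_sub_of_expansion`). -/

noncomputable section
namespace FlatContactPencil

/-! ### Expansions along stable towers -/

/-- An index of the `n`-th tower, as an index of the base component of the next one. -/
def baseEmb {n : ℕ} (i : TowerIdx n) : TowerIdx (n + 1) :=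
  (Sum.inl i : TowerIdx n ⊕ TowerIdx n)

/-- An index of the `n`-th tower, as an index of the direction component of the next one. -/
def dirEmb {n : ℕ} (i : TowerIdx n) : TowerIdx (n + 1) :=
  (Sum.inr i : TowerIdx n ⊕ TowerIdx n)

theorem elim_baseEmb {α : Type*} {n : ℕ} (f g : TowerIdx n → α) (D : TowerIdx (n + 1) → α)
    (h : D = Sum.elim f g) (i : TowerIdx n) : D (baseEmb i) = f i := by
  subst h; rfl

theorem elim_dirEmb {α : Type*} {n : ℕ} (f g : TowerIdx n → α) (D : TowerIdx (n + 1) → α)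
    (h : D = Sum.elim f g) (i : TowerIdx n) : D (dirEmb i) = g i := by
  subst h; rfl

/-- The index `i` of the `n`-th tower seen in the `(n + k)`-th one. -/
def liftIdx {n : ℕ} (i : TowerIdx n) : (k : ℕ) → TowerIdx (n + k)
  | 0 => i
  | k + 1 => baseEmb (liftIdx i k)

/-- The tangent direction at the `n`-th stage, read on the next point of the sequence. -/
def tangentAt (q : (n : ℕ) → Tower n) (n : ℕ) (i : TowerIdx n) : ℝ :=
  q (n + 1) (dirEmb i)

/-- A filtration of a ring by ideals `I N` together with an element `u` of weight one, and a lifted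
point `D` with directions `w`, such that the coordinate `i` of the tower remains, from stage `n` on,
of maximal size; `u` is a multiple of this coordinate. -/
structure StableTower (q : (n : ℕ) → Tower n) (n : ℕ) (i : TowerIdx n) {R : Type} [CommRing R]
    [Algebra ℝ R] (I : ℕ → Ideal R) (u : R) (D w : (k : ℕ) → TowerIdx (n + k) → R)
    (v : ℕ → R) : Prop where
  ideal_zero : I 0 = ⊤
  mul_mem : ∀ N a, a ∈ I N → u * a ∈ I (N + 1)
  step : ∀ k, D (k + 1) = Sum.elim (D k) (w k)
  -- This and the next relation are required modulo every `I N` instead of exactly, because for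
  -- functions on a trajectory they hold only near `0`.
  expand : ∀ N k j, D k j - algebraMap ℝ R (q (n + k) j) - u * (v k * w k j) ∈ I N
  inv : ∀ N k, algebraMap ℝ R (tangentAt q n i) * (v k * w k (liftIdx i k)) - 1 ∈ I N

open Polynomial in
/-- A polynomial with nonzero constant term is invertible modulo `X ^ N`. -/
theorem exists_inverse_mod_X_pow (P : ℝ[X]) (hP : P.coeff 0 ≠ 0) (N : ℕ) :
    ∃ Q S : ℝ[X], P * Q - 1 = X ^ N * S := by
  have h : IsCoprime P (X ^ N) := by
    refine IsCoprime.pow_right ?_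
    refine IsCoprime.symm ((Polynomial.irreducible_X.coprime_iff_not_dvd).2 ?_)
    rwa [X_dvd_iff]
  obtain ⟨a, b, hab⟩ := h
  exact ⟨a, -b, by linear_combination hab⟩

theorem StableTower.pow_mul_mem {q : (n : ℕ) → Tower n} {n : ℕ} {i : TowerIdx n} {R : Type}
    [CommRing R] [Algebra ℝ R] {I : ℕ → Ideal R} {u : R} {D w : (k : ℕ) → TowerIdx (n + k) → R}
    {v : ℕ → R} (h : StableTower q n i I u D w v) (N : ℕ) (a : R) : u ^ N * a ∈ I N := by
  induction N with
  | zero => simp [h.ideal_zero]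
  | succ N ih =>
    have := h.mul_mem N _ ih
    rwa [← mul_assoc, ← pow_succ'] at this

open Polynomial in
/-- The coordinates of a stable tower are polynomials in `u` modulo `I N`; the polynomials only
depend on the sequence `q`. -/
theorem StableTower.exists_polynomial (q : (n : ℕ) → Tower n) (n : ℕ) (i : TowerIdx n)
    (hq : ∀ k, tangentAt q (n + k) (liftIdx i k) ≠ 0) (N : ℕ) :
    ∀ k, ∃ A : TowerIdx (n + k) → ℝ[X], (∀ j, (A j).coeff 0 = q (n + k) j) ∧
      ∀ (R : Type) [CommRing R] [Algebra ℝ R] (I : ℕ → Ideal R) (u : R)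
        (D w : (k : ℕ) → TowerIdx (n + k) → R) (v : ℕ → R),
        StableTower q n i I u D w v → ∀ j, D k j - aeval u (A j) ∈ I (N + 1) := by
  induction N with
  | zero =>
    intro k
    refine ⟨fun j => Polynomial.C (q (n + k) j), by simp, fun R _ _ I u D w v h j => ?_⟩
    have h1 := h.expand 1 k j
    have h2 := h.mul_mem 0 (v k * w k j) (by simp [h.ideal_zero])
    have := (I 1).add_mem h1 h2
    simpa using this
  | succ N ih =>
    intro k
    -- The directions at stage `k` are coordinates of stage `k + 1`, known to order `N` by
    -- induction; the factor `u` in `expand` gains the missing order.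
    obtain ⟨A, hA0, hA⟩ := ih (k + 1)
    let W : TowerIdx (n + k) → ℝ[X] := fun j => A (dirEmb j)
    set κ := tangentAt q n i with hκ
    have hW0 : (Polynomial.C κ * W (liftIdx i k)).coeff 0 ≠ 0 := by
      have := hA0 (dirEmb (liftIdx i k))
      rw [coeff_C_mul, show (W (liftIdx i k)).coeff 0 = _ from this]
      exact mul_ne_zero (hq 0) (hq k)
    -- `Q` is the polynomial counterpart of `v k`: both invert `κ` times the direction along `i`,
    -- whence `e4`.
    obtain ⟨Q, S, hQS⟩ := exists_inverse_mod_X_pow _ hW0 (N + 1)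
    refine ⟨fun j => Polynomial.C (q (n + k) j) + X * (Q * W j), by simp, ?_⟩
    intro R _ _ I u D w v h j
    have hw : ∀ j, w k j - aeval u (W j) ∈ I (N + 1) := fun j => by
      have := hA R I u D w v h (dirEmb j)
      rwa [elim_dirEmb _ _ _ (h.step k)] at this
    set J := I (N + 1) with hJ
    have e1 := h.inv (N + 1) k
    rw [← hJ] at e1
    have e2 := hw (liftIdx i k)
    have e3 : algebraMap ℝ R κ * aeval u (W (liftIdx i k)) * aeval u Q - 1 ∈ J := by
      have := h.pow_mul_mem (N + 1) (aeval u S)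
      have h2 := congrArg (aeval u) hQS
      simp only [map_sub, map_mul, map_one, map_pow, aeval_X, aeval_C] at h2
      rw [h2]; exact this
    set a := w k (liftIdx i k)
    set b := aeval u (W (liftIdx i k))
    set c := aeval u Q
    set r := algebraMap ℝ R κ
    have e4 : v k - c ∈ J := by
      have : v k - c =
        (r * (v k * a) - 1) * c - r * v k * ((a - b) * c) - v k * (r * b * c - 1) := by ring
      rw [this]
      exact J.sub_mem (J.sub_mem (J.mul_mem_right _ e1)
        (J.mul_mem_left _ (J.mul_mem_right _ e2))) (J.mul_mem_left _ e3)
    have e5 : v k * w k j - c * aeval u (W j) ∈ J := by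
      have : v k * w k j - c * aeval u (W j) =
        (v k - c) * w k j + c * (w k j - aeval u (W j)) := by ring
      rw [this]
      exact J.add_mem (J.mul_mem_right _ e4) (J.mul_mem_left _ (hw j))
    have e6 := (I (N + 1 + 1)).add_mem (h.mul_mem _ _ e5) (h.expand (N + 1 + 1) k j)
    convert e6 using 1
    simp only [map_add, map_mul, aeval_C, aeval_X]
    ring

/-! ### The half-branch of a formal curve -/

/-- The index of a coordinate of `ℝ³` in the `n`-th tower. -/
def baseIdx : (n : ℕ) → Fin 3 → TowerIdx n
  | 0, j => j
  | n + 1, j => baseEmb (baseIdx n j)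

theorem SeriesPos.ne_zero {l : PowerSeries ℝ} (h : SeriesPos l) : l ≠ 0 := by
  rintro rfl
  obtain ⟨m, -, hm⟩ := h
  simp at hm

theorem SeriesPos.eq_of_sq_eq {l l' : PowerSeries ℝ} (h : SeriesPos l) (h' : SeriesPos l')
    (e : l ^ 2 = l' ^ 2) : l = l' := by
  rcases sq_eq_sq_iff_eq_or_eq_neg.1 e with e | e
  · exact e
  · exfalso
    obtain ⟨m, hm, hm0⟩ := h
    obtain ⟨m', hm', hm0'⟩ := h'
    subst e
    rcases lt_trichotomy m m' with hlt | rfl | hlt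
    · have := hm' m hlt
      simp [this] at hm0
    · simp at hm0
      linarith
    · have := hm m' hlt
      simp at this
      linarith

/-- As `w` is a unit vector, `l ^ 2` is the squared norm of `C - C(0)`. Positivity selects the
square root, and `w` is then a quotient in a domain. -/
theorem IsStrictTransform.unique {n : ℕ} {C : TowerIdx n → PowerSeries ℝ}
    {D D' : TowerIdx (n + 1) → PowerSeries ℝ} (h : IsStrictTransform C D)
    (h' : IsStrictTransform C D') : D = D' := by
  obtain ⟨l, w, hl, hw, e, rfl⟩ := h
  obtain ⟨l', w', hl', hw', e', rfl⟩ := h'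
  have key : ∀ i, l * w i = l' * w' i := fun i => by rw [← e, ← e']
  have hll : l = l' := by
    refine hl.eq_of_sq_eq hl' ?_
    calc l ^ 2 = ∑ i, (l * w i) ^ 2 := by simp_rw [mul_pow, ← Finset.mul_sum, hw, mul_one]
      _ = ∑ i, (l' * w' i) ^ 2 := by simp_rw [key]
      _ = l' ^ 2 := by simp_rw [mul_pow, ← Finset.mul_sum, hw', mul_one]
  subst hll
  have : w = w' := funext fun i => mul_left_cancel₀ hl.ne_zero (key i)
  rw [this]

/-- The sequence of oriented iterated tangents of a half-branch is unique. -/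
theorem IsHalfBranch.unique {C : FormalCurve} {p p' : (n : ℕ) → Tower n} (h : IsHalfBranch C p)
    (h' : IsHalfBranch C p') : p = p' := by
  obtain ⟨D, h0, hD, hp⟩ := h
  obtain ⟨D', h0', hD', hp'⟩ := h'
  have : ∀ n, D n = D' n := by
    intro n
    induction n with
    | zero => rw [h0, h0']
    | succ n ih =>
      have h2 := hD' n
      rw [← ih] at h2
      exact (hD n).unique h2
  funext n
  rw [hp, hp', this n]

/-- Along the half-branch of a formal curve, some coordinate of the tower remains of maximal size
from some stage on. -/
theorem IsHalfBranch.exists_stableTower {C : FormalCurve} {p : (n : ℕ) → Tower n}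
    (h : IsHalfBranch C p) :
    ∃ (n : ℕ) (i : TowerIdx n), (∀ k, tangentAt p (n + k) (liftIdx i k) ≠ 0) ∧
      ∃ (U : PowerSeries ℝ) (D w : (k : ℕ) → TowerIdx (n + k) → PowerSeries ℝ)
        (v : ℕ → PowerSeries ℝ), PowerSeries.constantCoeff U = 0 ∧
        StableTower p n i (fun N => Ideal.span {(PowerSeries.X : PowerSeries ℝ) ^ N}) U D w v ∧
        (∀ j, D 0 (baseIdx n j) = C.toFun j) ∧ ∀ j, p n (baseIdx n j) = 0 := by
  obtain ⟨D, h0, hD, hp⟩ := h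
  choose l w hl hw e hstep using hD
  have hp' : ∀ n j, PowerSeries.constantCoeff (D n j) = p n j := fun n j => by rw [hp]
  have hl0 : ∀ n, l n ≠ 0 := fun n => (hl n).ne_zero
  have hunit : ∀ n, ∃ i, PowerSeries.constantCoeff (w n i) ≠ 0 := by
    intro n
    by_contra! hc
    have := congrArg PowerSeries.constantCoeff (hw n)
    simp [hc] at this
  have hstep' : ∀ n j, l n * w n j =
      l (n + 1) * w (n + 1) (baseEmb j) := by
    intro n j
    rw [← e, ← e, elim_baseEmb _ _ _ (hstep n)]
  have hord : ∀ n j, PowerSeries.constantCoeff (w n j) ≠ 0 →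
      (l n * w n j).order = (l n).order := by
    intro n j hj
    rw [PowerSeries.order_mul, PowerSeries.order_zero_of_unit (f := w n j), add_zero]
    rwa [PowerSeries.isUnit_iff_constantCoeff, isUnit_iff_ne_zero]
  -- Some direction component is a unit, so `l n` has the order of a coordinate of `C_n - p n`; this
  -- coordinate persists at the next stage, where it is a multiple of `l (n + 1)`.
  have hanti : Antitone fun n => (l n).order := by
    refine antitone_nat_of_succ_le fun n => ?_
    obtain ⟨i, hi⟩ := hunit n
    rw [← hord n i hi, hstep', PowerSeries.order_mul]
    exact le_self_add
  obtain ⟨n, hn⟩ : ∃ n, ∀ m, n ≤ m → (l n).order = (l m).order := by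
    exact WellFoundedGT.monotone_chain_condition
      (⟨fun n => OrderDual.toDual (l n).order, fun a b hab => hanti hab⟩ : ℕ →o ℕ∞ᵒᵈ)
  obtain ⟨i, hi⟩ := hunit n
  have hlift : ∀ k, l (n + k) * w (n + k) (liftIdx i k) = l n * w n i := by
    intro k
    induction k with
    | zero => rfl
    | succ k ih => rw [← ih, hstep' (n + k)]; rfl
  -- The product `l * w` along `i` does not depend on the stage, and `l` has constant order from
  -- stage `n` on; so this direction component keeps order zero.
  have hne : ∀ k, PowerSeries.constantCoeff (w (n + k) (liftIdx i k)) ≠ 0 := by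
    intro k
    have h1 := congrArg PowerSeries.order (hlift k)
    rw [hord n i hi, hn (n + k) (Nat.le_add_right _ _), PowerSeries.order_mul] at h1
    have h2 : (w (n + k) (liftIdx i k)).order = 0 := by
      have h3 : (l (n + k)).order ≠ ⊤ := by
        rw [Ne, PowerSeries.order_eq_top]; exact hl0 _
      exact (WithTop.add_left_inj h3).1 (h1.trans (add_zero _).symm)
    intro h4
    have := PowerSeries.one_le_order_iff_constCoeff_eq_zero.2 h4
    rw [h2] at this
    simp at this
  have htan : ∀ n j, tangentAt p n j = PowerSeries.constantCoeff (w n j) := by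
    intro n j
    rw [tangentAt, ← hp', elim_dirEmb _ _ _ (hstep n)]
  refine ⟨n, i, fun k => by rw [htan]; exact hne k, ?_⟩
  set κ : ℝ := tangentAt p n i with hκ
  have hκ0 : κ ≠ 0 := by rw [hκ, htan]; exact hi
  refine ⟨PowerSeries.C κ * (l n * w n i), fun k => D (n + k), fun k => w (n + k),
    fun k => (PowerSeries.C κ * w (n + k) (liftIdx i k))⁻¹, ?_, ⟨?_, ?_, ?_, ?_, ?_⟩, ?_, ?_⟩
  · rw [← e]; simp
  · simp
  · intro N a ha
    rw [Ideal.mem_span_singleton] at ha ⊢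
    rw [pow_succ']
    refine mul_dvd_mul ?_ ha
    rw [← e, PowerSeries.X_dvd_iff]
    simp
  · exact fun k => hstep (n + k)
  · intro N k j
    have h1 : D (n + k) j - algebraMap ℝ (PowerSeries ℝ) (p (n + k) j) =
        l (n + k) * w (n + k) j := by rw [← hp']; exact e _ _
    have h2 : PowerSeries.constantCoeff (PowerSeries.C κ * w (n + k) (liftIdx i k)) ≠ 0 := by
      simp [hκ0, hne k]
    rw [h1, ← hlift k]
    have h3 := PowerSeries.mul_inv_cancel _ h2
    have h4 : l (n + k) * w (n + k) j - PowerSeries.C κ * (l (n + k) * w (n + k) (liftIdx i k)) *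
      ((PowerSeries.C κ * w (n + k) (liftIdx i k))⁻¹ * w (n + k) j) = 0 := by
      linear_combination -(l (n + k) * w (n + k) j) * h3
    rw [h4]
    exact Ideal.zero_mem _
  · intro N k
    have h2 : PowerSeries.constantCoeff (PowerSeries.C κ * w (n + k) (liftIdx i k)) ≠ 0 := by
      simp [hκ0, hne k]
    have h3 := PowerSeries.mul_inv_cancel _ h2
    have h4 : algebraMap ℝ (PowerSeries ℝ) κ *
        ((PowerSeries.C κ * w (n + k) (liftIdx i k))⁻¹ * w (n + k) (liftIdx i k)) - 1 = 0 := by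
      rw [show algebraMap ℝ (PowerSeries ℝ) κ = PowerSeries.C κ from rfl]
      linear_combination h3
    rw [h4]
    exact Ideal.zero_mem _
  all_goals
    have hb : ∀ n j, D n (baseIdx n j) = C.toFun j := by
      intro n j
      induction n with
      | zero => rw [h0]; rfl
      | succ n ih => rw [← ih]; exact elim_baseEmb _ _ _ (hstep n) _
  · exact hb n
  · intro j
    rw [← hp', hb, C.constantCoeff_eq_zero]

open Asymptotics

/-! ### Lifting points to the towers -/

/-- The point of the `n`-th tower over a point of `ℝ³ ∖ {0}`. -/
def liftPt (q : (n : ℕ) → Tower n) : (n : ℕ) → R3 → Tower n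
  | 0, p => p
  | n + 1, p => WithLp.toLp 2 (Sum.elim (fun i => liftPt q n p i)
      (fun i => ‖liftPt q n p - q n‖⁻¹ * (liftPt q n p i - q n i)))

theorem liftPt_dirEmb (q : (n : ℕ) → Tower n) (n : ℕ) (p : R3) (i : TowerIdx n) :
    liftPt q (n + 1) p (dirEmb i) = ‖liftPt q n p - q n‖⁻¹ * (liftPt q n p i - q n i) := rfl

theorem base_liftPt (q : (n : ℕ) → Tower n) (n : ℕ) (p : R3) :
    base (liftPt q (n + 1) p) = liftPt q n p := rfl

theorem direction_liftPt (q : (n : ℕ) → Tower n) (n : ℕ) (p : R3) :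
    direction (liftPt q (n + 1) p) = ‖liftPt q n p - q n‖⁻¹ • (liftPt q n p - q n) := rfl

theorem continuous_base {n : ℕ} : Continuous (base : Tower (n + 1) → Tower n) := by
  unfold base
  refine (PiLp.continuous_toLp 2 _).comp (continuous_pi fun i => ?_)
  exact (PiLp.continuous_apply 2 _ (baseEmb i))

theorem continuous_direction {n : ℕ} : Continuous (direction : Tower (n + 1) → Tower n) := by
  unfold direction
  refine (PiLp.continuous_toLp 2 _).comp (continuous_pi fun i => ?_)
  exact (PiLp.continuous_apply 2 _ (dirEmb i))

theorem norm_sq_eq_base_add_direction {n : ℕ} (m : Tower (n + 1)) :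
    ‖m‖ ^ 2 = ‖base m‖ ^ 2 + ‖direction m‖ ^ 2 := by
  rw [EuclideanSpace.norm_sq_eq, EuclideanSpace.norm_sq_eq, EuclideanSpace.norm_sq_eq]
  exact Fintype.sum_sum_type (fun i : TowerIdx n ⊕ TowerIdx n => ‖m i‖ ^ 2)

theorem HasIteratedTangents.base_succ {Γ : Set R3} {q : (n : ℕ) → Tower n}
    (h : HasIteratedTangents Γ q) (n : ℕ) : base (q (n + 1)) = q n :=
  ((h.2 n _).2 rfl).2.1

/-- A lift equal to a centre would project to a lift equal to the previous centre, down to `p = 0`.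
Hence the inverse norm in `liftPt` never takes its default value when `p ≠ 0`. -/
theorem HasIteratedTangents.liftPt_ne {Γ : Set R3} {q : (n : ℕ) → Tower n}
    (h : HasIteratedTangents Γ q) {p : R3} (hp : p ≠ 0) (n : ℕ) : liftPt q n p ≠ q n := by
  induction n with
  | zero => rw [h.1]; exact hp
  | succ n ih =>
    intro hc
    apply ih
    rw [← base_liftPt, hc, h.base_succ]

theorem HasIteratedTangents.norm_direction_liftPt {Γ : Set R3} {q : (n : ℕ) → Tower n}
    (h : HasIteratedTangents Γ q) {p : R3} (hp : p ≠ 0) (n : ℕ) :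
    ‖direction (liftPt q (n + 1) p)‖ = 1 := by
  rw [direction_liftPt, norm_smul, norm_inv, norm_norm, inv_mul_cancel₀]
  rw [norm_ne_zero_iff, sub_ne_zero]
  exact h.liftPt_ne hp n

theorem HasIteratedTangents.liftPt_mem {Γ : Set R3} {q : (n : ℕ) → Tower n}
    (h : HasIteratedTangents Γ q) {p : R3} (hp : p ≠ 0) (hpΓ : p ∈ Γ) (n : ℕ) :
    liftPt q n p ∈ liftSet Γ q n := by
  induction n with
  | zero => exact hpΓ
  | succ n ih =>
    refine ⟨⟨h.norm_direction_liftPt hp n, ?_⟩, ih⟩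
    rw [base_liftPt, direction_liftPt, smul_smul, mul_inv_cancel₀, one_smul]
    rw [norm_ne_zero_iff, sub_ne_zero]
    exact h.liftPt_ne hp n

/-- Along a set with iterated oriented tangents `q`, the lifted points tend to `q`. -/
theorem HasIteratedTangents.tendsto_liftPt {Γ : Set R3} {q : (n : ℕ) → Tower n}
    (h : HasIteratedTangents Γ q) (h0 : (0 : R3) ∉ Γ) (n : ℕ) :
    Tendsto (liftPt q n) (𝓝[Γ] 0) (𝓝 (q n)) := by
  induction n with
  | zero =>
    rw [h.1]
    exact tendsto_id.mono_left nhdsWithin_le_nhds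
  | succ n ih =>
    have hΓ : ∀ᶠ p in 𝓝[Γ] (0 : R3), p ∈ Γ ∧ p ≠ 0 :=
      eventually_nhdsWithin_of_forall fun p hp => ⟨hp, fun hc => h0 (hc ▸ hp)⟩
    -- The base of the lift converges and its direction has norm one, so the lifts stay in a compact
    -- ball. It remains to see that `q (n + 1)` is their only cluster point.
    have hK := isCompact_closedBall (0 : Tower (n + 1)) (‖q n‖ + 2)
    have hmem : ∀ᶠ p in 𝓝[Γ] (0 : R3),
        liftPt q (n + 1) p ∈ Metric.closedBall (0 : Tower (n + 1)) (‖q n‖ + 2) := by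
      have h1 : ∀ᶠ p in 𝓝[Γ] (0 : R3), ‖liftPt q n p‖ < ‖q n‖ + 1 :=
        ih.norm.eventually_lt_const (by linarith)
      filter_upwards [h1, hΓ] with p hp hp'
      rw [mem_closedBall_zero_iff]
      have h2 := norm_sq_eq_base_add_direction (liftPt q (n + 1) p)
      rw [h.norm_direction_liftPt hp'.2, base_liftPt] at h2
      refine abs_le_of_sq_le_sq' ?_ (by positivity) |>.2
      rw [h2]
      nlinarith [norm_nonneg (liftPt q n p), norm_nonneg (q n)]
    refine hK.tendsto_nhds_of_unique_mapClusterPt hmem fun y _ hy => ?_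
    have hbase : base y = q n := by
      have h1 : MapClusterPt (base y) (𝓝[Γ] (0 : R3)) (liftPt q n) :=
        hy.continuousAt_comp continuous_base.continuousAt
      have h2 : ClusterPt (base y) (𝓝 (q n)) := ClusterPt.mono h1 ih
      exact eq_of_nhds_neBot h2
    have hdir : ‖direction y‖ = 1 := by
      have h1 : MapClusterPt ‖direction y‖ (𝓝[Γ] (0 : R3))
          (fun p => ‖direction (liftPt q (n + 1) p)‖) :=
        MapClusterPt.continuousAt_comp (f := fun y => ‖direction y‖)
          continuous_direction.norm.continuousAt hy
      have h3 : Tendsto (fun p => ‖direction (liftPt q (n + 1) p)‖) (𝓝[Γ] (0 : R3)) (𝓝 1) := by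
        refine tendsto_const_nhds.congr' ?_
        filter_upwards [hΓ] with p hp
        rw [h.norm_direction_liftPt hp.2]
      exact eq_of_nhds_neBot (ClusterPt.mono h1 h3)
    -- The cluster point `y` lies in the fibre over `q n` and the lifts do not, so they differ from
    -- `y`, which is a genuine accumulation point.
    refine (h.2 n y).1 ⟨⟨hdir, by simp [hbase]⟩, hbase, ?_⟩
    rw [accPt_iff_frequently]
    rw [mapClusterPt_iff_frequently] at hy
    rw [frequently_iff]
    intro s hs
    obtain ⟨p, hp, hp'⟩ := ((hy s hs).and_eventually hΓ).exists
    refine ⟨_, hp, fun hc => ?_, h.liftPt_mem hp'.2 hp'.1 (n + 1)⟩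
    apply h.liftPt_ne hp'.2 n
    rw [← base_liftPt, hc, hbase]

/-! ### Asymptotic expansions along sets -/

/-- The algebra of functions that are bounded along a filter. -/
def boundedAlg {α : Type} (F : Filter α) : Subalgebra ℝ (α → ℝ) where
  carrier := {f | f =O[F] (fun _ => (1 : ℝ))}
  mul_mem' {f g} hf hg := by simpa using hf.mul hg
  add_mem' {f g} hf hg := hf.add hg
  algebraMap_mem' r := isBigO_const_const r one_ne_zero F

/-- The ideal of functions that are `O(u ^ N)`. -/
def bigOIdeal {α : Type} (F : Filter α) (u : α → ℝ) (N : ℕ) : Ideal (boundedAlg F) where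
  carrier := {f | f.1 =O[F] fun p => u p ^ N}
  add_mem' {f g} hf hg := hf.add hg
  zero_mem' := isBigO_zero _ _
  smul_mem' c f hf := by
    change (fun p => c.1 p * f.1 p) =O[F] _
    simpa using c.2.mul hf

theorem mem_boundedAlg_of_tendsto {α : Type} {F : Filter α} {f : α → ℝ} {c : ℝ}
    (h : Tendsto f F (𝓝 c)) : f ∈ boundedAlg F :=
  h.isBigO_one ℝ

theorem aeval_boundedAlg {α : Type} (F : Filter α) (u : boundedAlg F) (P : Polynomial ℝ) (a : α) :
    (Polynomial.aeval u P).1 a = P.eval (u.1 a) := by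
  have h1 : (Polynomial.aeval u P).1 = Polynomial.aeval u.1 P :=
    (Polynomial.aeval_algHom_apply (boundedAlg F).val u P).symm
  rw [h1]
  have := Polynomial.aeval_algHom_apply (Pi.evalAlgHom ℝ (fun _ : α => ℝ) a) u.1 P
  rw [show (Polynomial.aeval u.1 P) a = _ from this.symm]
  rw [Polynomial.aeval_def, Polynomial.eval₂_eq_eval_map]
  simp

/-- The points of `S` near `0` have the asymptotic expansion `p ~ A(u)`, where the function `u` is
positive and tends to `0`. -/
structure IsAsymptotic (A : ℕ → Fin 3 → Polynomial ℝ) (S : Set R3) (u : R3 → ℝ) : Prop where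
  tendsto : Tendsto u (𝓝[S] 0) (𝓝 0)
  pos : ∀ᶠ p in 𝓝[S] 0, 0 < u p
  expand : ∀ N j, (fun p : R3 => p j - (A N j).eval (u p)) =O[𝓝[S] 0] fun p => u p ^ N

/-- This is the analogue of `IsHalfBranch.exists_stableTower` in the ring of functions bounded along
`Γ`, where boundedness comes from the convergence of the lifts. The stage `n` and the index `i` are
not found again: `hq` concerns `q` alone and is supplied by the axis. The factor `κ` makes `u`
positive, since `κ` times the direction along `i` tends to `κ ^ 2`. -/
theorem HasIteratedTangents.stableTower {Γ : Set R3} {q : (n : ℕ) → Tower n}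
    (h : HasIteratedTangents Γ q) (h0 : (0 : R3) ∉ Γ) (n : ℕ) (i : TowerIdx n)
    (hq : ∀ k, tangentAt q (n + k) (liftIdx i k) ≠ 0) :
    ∃ (u : boundedAlg (𝓝[Γ] (0 : R3))) (D w : (k : ℕ) → TowerIdx (n + k) →
        boundedAlg (𝓝[Γ] (0 : R3))) (v : ℕ → boundedAlg (𝓝[Γ] (0 : R3))),
      Tendsto u.1 (𝓝[Γ] 0) (𝓝 0) ∧ (∀ᶠ p in 𝓝[Γ] 0, 0 < u.1 p) ∧
      StableTower q n i (bigOIdeal (𝓝[Γ] (0 : R3)) u.1) u D w v ∧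
      ∀ j p, (D 0 (baseIdx n j)).1 p = p j := by
  have hco : ∀ n j, Tendsto (fun p => liftPt q n p j) (𝓝[Γ] 0) (𝓝 (q n j)) := fun n j =>
    ((PiLp.continuous_apply 2 _ j).tendsto _).comp (h.tendsto_liftPt h0 n)
  have hΓ : ∀ᶠ p in 𝓝[Γ] (0 : R3), p ≠ 0 :=
    eventually_nhdsWithin_of_forall fun p hp hc => h0 (hc ▸ hp)
  set κ := tangentAt q n i with hκ
  have hκ0 : κ ≠ 0 := hq 0
  have hlift : ∀ k p, liftPt q (n + k) p (liftIdx i k) = liftPt q n p i := by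
    intro k p
    induction k with
    | zero => rfl
    | succ k ih => rw [← ih]; rfl
  have hqlift : ∀ k, q (n + k) (liftIdx i k) = q n i := by
    intro k
    induction k with
    | zero => rfl
    | succ k ih => rw [← ih, ← h.base_succ (n + k)]; rfl
  have hr : ∀ m (p : R3), p ≠ 0 → ‖liftPt q m p - q m‖ ≠ 0 := fun m p hp => by
    rw [norm_ne_zero_iff, sub_ne_zero]; exact h.liftPt_ne hp m
  have hw : ∀ k, ∀ᶠ p in 𝓝[Γ] (0 : R3), liftPt q (n + k + 1) p (dirEmb (liftIdx i k)) ≠ 0 :=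
    fun k => (hco (n + k + 1) (dirEmb (liftIdx i k))).eventually_ne (hq k)
  have hu : Tendsto (fun p => κ * (liftPt q n p i - q n i)) (𝓝[Γ] 0) (𝓝 0) := by
    simpa using ((hco n i).sub_const (q n i)).const_mul κ
  refine ⟨⟨fun p => κ * (liftPt q n p i - q n i), mem_boundedAlg_of_tendsto hu⟩,
    fun k j => ⟨fun p => liftPt q (n + k) p j, mem_boundedAlg_of_tendsto (hco _ _)⟩,
    fun k j => ⟨fun p => liftPt q (n + k + 1) p (dirEmb j), mem_boundedAlg_of_tendsto (hco _ _)⟩,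
    fun k => ⟨fun p => (κ * liftPt q (n + k + 1) p (dirEmb (liftIdx i k)))⁻¹,
      mem_boundedAlg_of_tendsto (((hco _ _).const_mul κ).inv₀ (mul_ne_zero hκ0 (hq k)))⟩,
    hu, ?_, ⟨?_, ?_, ?_, ?_, ?_⟩, ?_⟩
  · have h1 : ∀ᶠ p in 𝓝[Γ] (0 : R3), 0 < κ * liftPt q (n + 1) p (dirEmb i) :=
      ((hco (n + 1) (dirEmb i)).const_mul κ).eventually_const_lt (mul_self_pos.2 hκ0)
    filter_upwards [h1, hΓ] with p hp hp'
    rw [liftPt_dirEmb] at hp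
    have h2 : 0 < ‖liftPt q n p - q n‖ := lt_of_le_of_ne (norm_nonneg _) (hr n p hp').symm
    have h3 : κ * (liftPt q n p i - q n i) = ‖liftPt q n p - q n‖ *
        (κ * (‖liftPt q n p - q n‖⁻¹ * (liftPt q n p i - q n i))) := by
      field_simp
    change 0 < κ * (liftPt q n p i - q n i)
    rw [h3]
    exact mul_pos h2 hp
  · rw [Ideal.eq_top_iff_one]
    change (fun _ => (1 : ℝ)) =O[_] _
    exact (isBigO_refl (fun _ => (1 : ℝ)) _).congr_right (by simp)
  · intro N a ha
    change (fun p => _) =O[_] _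
    simp_rw [pow_succ']
    exact (isBigO_refl _ _).mul ha
  · intro k
    funext j
    match j with
    | Sum.inl j => rfl
    | Sum.inr j => rfl
  · intro N k j
    refine IsBigO.congr' (isBigO_zero _ _) ?_ EventuallyEq.rfl
    filter_upwards [hΓ, hw k] with p hp hwp
    change 0 = liftPt q (n + k) p j - q (n + k) j - κ * (liftPt q n p i - q n i) *
      ((κ * liftPt q (n + k + 1) p (dirEmb (liftIdx i k)))⁻¹ * liftPt q (n + k + 1) p (dirEmb j))
    have hrp := hr (n + k) p hp
    rw [liftPt_dirEmb] at hwp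
    rw [liftPt_dirEmb, liftPt_dirEmb]
    rw [hlift, hqlift] at hwp ⊢
    have h4 : liftPt q n p i - q n i ≠ 0 := right_ne_zero_of_mul hwp
    field_simp
    ring
  · intro N k
    refine IsBigO.congr' (isBigO_zero _ _) ?_ EventuallyEq.rfl
    filter_upwards [hw k] with p hwp
    change 0 = κ * ((κ * liftPt q (n + k + 1) p (dirEmb (liftIdx i k)))⁻¹ *
      liftPt q (n + k + 1) p (dirEmb (liftIdx i k))) - 1
    field_simp
    ring
  · intro j p
    change liftPt q n p (baseIdx n j) = p j
    clear * -
    induction n with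
    | zero => rfl
    | succ n ih => rw [← ih]; rfl

/-- The trajectories of an integral pencil have the same asymptotic expansion as the axis. -/
theorem exists_expansion (C : FormalCurve) (q : (n : ℕ) → Tower n) (hC : IsHalfBranch C q) :
    ∃ A : ℕ → Fin 3 → Polynomial ℝ, (∀ N j, (A N j).coeff 0 = 0) ∧
      (∃ U : PowerSeries ℝ, PowerSeries.constantCoeff U = 0 ∧
        ∀ N j, (PowerSeries.X : PowerSeries ℝ) ^ N ∣ C.toFun j - Polynomial.aeval U (A N j)) ∧
      ∀ Γ : Set R3, (0 : R3) ∉ Γ → HasIteratedTangents Γ q → ∃ u, IsAsymptotic A Γ u := by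
  obtain ⟨n, i, hq, U, D, w, v, hU, hst, hD, hq0⟩ := hC.exists_stableTower
  -- The polynomials are fixed before any ring or trajectory is chosen; the same ones serve the axis
  -- and all members of the pencil.
  choose A hA0 hA using fun N => StableTower.exists_polynomial q n i hq N 0
  refine ⟨fun N j => A N (baseIdx n j), fun N j => (hA0 N _).trans (hq0 j), ⟨U, hU, ?_⟩, ?_⟩
  · intro N j
    have := hA N _ _ U D w v hst (baseIdx n j)
    rw [hD, Ideal.mem_span_singleton] at this
    exact (pow_dvd_pow _ N.le_succ).trans this
  · intro Γ hΓ h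
    obtain ⟨u, D', w', v', hu, hpos, hst', hD'⟩ := h.stableTower hΓ n i hq
    refine ⟨u.1, hu, hpos, fun N j => ?_⟩
    have h1 : (D' 0 (baseIdx n j) - Polynomial.aeval u (A N (baseIdx n j))).1
        =O[𝓝[Γ] 0] fun p => u.1 p ^ (N + 1) := hA N _ _ u D' w' v' hst' (baseIdx n j)
    have h2 : (fun p : R3 => p j - (A N (baseIdx n j)).eval (u.1 p))
        =O[𝓝[Γ] 0] fun p => u.1 p ^ (N + 1) := by
      refine h1.congr_left fun p => ?_
      rw [← aeval_boundedAlg, ← hD']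
      rfl
    refine h2.trans ?_
    simp_rw [pow_succ]
    simpa using (isBigO_refl (fun p => u.1 p ^ N) (𝓝[Γ] 0)).mul (hu.isBigO_one ℝ)

/-! ### Restriction of analytic functions to a formal curve -/

theorem isBigO_euclidean {α ι : Type*} [Fintype ι] {F : Filter α} {f : α → EuclideanSpace ℝ ι}
    {g : α → ℝ} (h : ∀ j, (fun a => f a j) =O[F] g) : f =O[F] g := by
  have h1 : (fun a => (f a).ofLp) =O[F] g := isBigO_pi.2 h
  exact ((PiLp.continuousLinearEquiv 2 ℝ (fun _ : ι => ℝ)).symm.toContinuousLinearMap.isBigO_comp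
    (fun a => (f a).ofLp) F).trans h1

theorem not_isBigO_pow_of_eq_pow_smul {g h : ℝ → ℝ} {m N : ℕ} (hmN : m < N)
    (hh : ContinuousAt h 0) (h0 : h 0 ≠ 0) (hg : ∀ᶠ t in 𝓝 0, g t = t ^ m * h t) :
    ¬ g =O[𝓝 0] fun t => t ^ N := by
  intro hc
  have h1 : (fun t : ℝ => t ^ m) =O[𝓝 0] g := by
    have h2 : (fun t => g t * (h t)⁻¹) =O[𝓝 0] fun t => g t * (1 : ℝ) :=
      (isBigO_refl g _).mul ((hh.inv₀ h0).tendsto.isBigO_one ℝ)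
    refine (h2.congr' ?_ (by simp [EventuallyEq.refl]))
    filter_upwards [hg, hh.eventually_ne h0] with t ht ht'
    rw [ht]
    field_simp
  have h3 : (fun t : ℝ => t ^ m) =o[𝓝 0] fun t : ℝ => t ^ m :=
    (h1.trans hc).trans_isLittleO (isLittleO_pow_pow hmN)
  have h4 := h3.mono (nhdsWithin_le_nhds (s := {0}ᶜ))
  refine isLittleO_irrefl ?_ h4
  refine Eventually.frequently ?_
  filter_upwards [self_mem_nhdsWithin] with t ht
  exact pow_ne_zero _ ht

theorem exists_eq_pow_mul_of_not_isBigO {g : ℝ → ℝ} (hg : AnalyticAt ℝ g 0) {N : ℕ}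
    (h : ¬ g =O[𝓝 0] fun t => t ^ N) :
    ∃ (m : ℕ) (k : ℝ → ℝ), m < N ∧ AnalyticAt ℝ k 0 ∧ k 0 ≠ 0 ∧
      ∀ᶠ t in 𝓝 0, g t = t ^ m * k t := by
  have hne : analyticOrderAt g 0 ≠ ⊤ := by
    intro hc
    rw [analyticOrderAt_eq_top] at hc
    exact h ((isBigO_zero _ _).congr' (hc.mono fun z hz => hz.symm) EventuallyEq.rfl)
  obtain ⟨k, hk, hk0, hgk⟩ := (hg.analyticOrderAt_ne_top).1 hne
  simp only [sub_zero, smul_eq_mul] at hgk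
  refine ⟨_, k, ?_, hk, hk0, hgk⟩
  by_contra! hc
  apply h
  have h1 : (fun t : ℝ => t ^ analyticOrderNatAt g 0 * k t) =O[𝓝 0]
      fun t => t ^ analyticOrderNatAt g 0 * (1 : ℝ) :=
    (isBigO_refl _ _).mul (hk.continuousAt.tendsto.isBigO_one ℝ)
  have h2 : g =O[𝓝 0] fun t : ℝ => t ^ analyticOrderNatAt g 0 :=
    h1.congr' (hgk.mono fun z hz => hz.symm) (by simp [EventuallyEq.refl])
  refine h2.trans ?_
  rcases hc.eq_or_lt with e | hlt
  · rw [e]; exact isBigO_refl _ _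
  · exact (isLittleO_pow_pow hlt).isBigO

theorem iteratedDeriv_eq_zero_of_isBigO {g : ℝ → ℝ} (hg : AnalyticAt ℝ g 0) {k : ℕ}
    (h : g =O[𝓝 0] fun t => t ^ (k + 1)) : iteratedDeriv k g 0 = 0 := by
  have h1 : ((k + 1 : ℕ) : ℕ∞) ≤ analyticOrderAt g 0 := by
    by_contra! hc
    have hne : analyticOrderAt g 0 ≠ ⊤ := hc.ne_top
    obtain ⟨f, hf, hf0, hgf⟩ := (hg.analyticOrderAt_ne_top).1 hne
    simp only [sub_zero, smul_eq_mul] at hgf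
    rw [← Nat.cast_analyticOrderNatAt hne, Nat.cast_lt] at hc
    exact not_isBigO_pow_of_eq_pow_smul hc hf.continuousAt hf0 hgf h
  exact (natCast_le_analyticOrderAt_iff_iteratedDeriv_eq_zero hg).1 h1 k (Nat.lt_succ_self k)

theorem X_pow_dvd_of_isBigO {P : Polynomial ℝ} {N : ℕ}
    (h : (fun t => P.eval t) =O[𝓝 0] fun t => t ^ N) : Polynomial.X ^ N ∣ P := by
  by_cases hP : P = 0
  · simp [hP]
  obtain ⟨Q, hQ, hQ0⟩ := Polynomial.exists_eq_pow_rootMultiplicity_mul_and_not_dvd P hP 0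
  simp only [map_zero, sub_zero] at hQ hQ0
  rw [Polynomial.X_dvd_iff, Polynomial.coeff_zero_eq_eval_zero] at hQ0
  rcases lt_or_ge (P.rootMultiplicity 0) N with hlt | hge
  · refine absurd h (not_isBigO_pow_of_eq_pow_smul (h := fun t => Q.eval t) hlt
      Q.continuous.continuousAt hQ0 (Eventually.of_forall fun t => ?_))
    conv_lhs => rw [hQ]
    simp
  · exact (pow_dvd_pow _ hge).trans ⟨Q, hQ⟩

/-- The curve of `ℝ³` given by the `N`-th polynomials of an expansion. -/
def polyCurve (A : ℕ → Fin 3 → Polynomial ℝ) (N : ℕ) (s : ℝ) : R3 :=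
  WithLp.toLp 2 fun j => (A N j).eval s

theorem analyticAt_toLp_eval (P : Fin 3 → Polynomial ℝ) (s : ℝ) :
    AnalyticAt ℝ (fun s => (WithLp.toLp 2 fun j => (P j).eval s : R3)) s := by
  have h : AnalyticAt ℝ (fun s => fun j => (P j).eval s) s := by
    rw [analyticAt_pi_iff]
    intro j
    simpa using AnalyticAt.aeval_polynomial (analyticAt_id (𝕜 := ℝ) (z := s)) (P j)
  exact ((PiLp.continuousLinearEquiv 2 ℝ (fun _ : Fin 3 => ℝ)).symm.analyticAt _).comp h

theorem polyCurve_zero {A : ℕ → Fin 3 → Polynomial ℝ} (hA : ∀ N j, (A N j).coeff 0 = 0) (N : ℕ) :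
    polyCurve A N 0 = 0 := by
  ext j
  simp [polyCurve, ← Polynomial.coeff_zero_eq_eval_zero, hA]

theorem isBigO_sub_of_analyticAt {α : Type*} {F : Filter α} {f : R3 → ℝ} (hf : AnalyticAt ℝ f 0)
    {x y : α → R3} (hx : Tendsto x F (𝓝 0)) (hy : Tendsto y F (𝓝 0)) :
    (fun a => f (x a) - f (y a)) =O[F] fun a => x a - y a :=
  (hf.hasStrictFDerivAt.isBigO_sub).comp_tendsto (hx.prodMk_nhds hy)

/-- The function `f` vanishes formally along the curve with expansion `A`. -/
def IsFlat (A : ℕ → Fin 3 → Polynomial ℝ) (f : R3 → ℝ) : Prop :=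
  -- The `N`-th polynomials describe the curve up to `O(u ^ N)`, so they are tested only to that
  -- order.
  ∀ N, (fun s => f (polyCurve A N s)) =O[𝓝 0] fun s => s ^ N

theorem tendsto_polyCurve {A : ℕ → Fin 3 → Polynomial ℝ} (hA : ∀ N j, (A N j).coeff 0 = 0)
    (N : ℕ) : Tendsto (polyCurve A N) (𝓝 0) (𝓝 0) := by
  have := (analyticAt_toLp_eval (A N) 0).continuousAt.tendsto
  rwa [show (WithLp.toLp 2 fun j => (A N j).eval 0 : R3) = 0 from polyCurve_zero hA N] at this

theorem IsAsymptotic.isBigO_sub {A : ℕ → Fin 3 → Polynomial ℝ} (hA : ∀ N j, (A N j).coeff 0 = 0)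
    {S : Set R3} {u : R3 → ℝ} (h : IsAsymptotic A S u) {f : R3 → ℝ} (hf : AnalyticAt ℝ f 0)
    (N : ℕ) : (fun p => f p - f (polyCurve A N (u p))) =O[𝓝[S] 0] fun p => u p ^ N := by
  refine (isBigO_sub_of_analyticAt hf (tendsto_id.mono_left nhdsWithin_le_nhds)
    ((tendsto_polyCurve hA N).comp h.tendsto)).trans ?_
  exact isBigO_euclidean fun j => h.expand N j

theorem IsFlat.isBigO {A : ℕ → Fin 3 → Polynomial ℝ} (hA : ∀ N j, (A N j).coeff 0 = 0)
    {f : R3 → ℝ} (hf : AnalyticAt ℝ f 0) (hfl : IsFlat A f) {S : Set R3} {u : R3 → ℝ}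
    (h : IsAsymptotic A S u) (N : ℕ) : f =O[𝓝[S] 0] fun p => u p ^ N := by
  have h1 := (h.isBigO_sub hA hf N).add ((hfl N).comp_tendsto h.tendsto)
  exact h1.congr_left fun p => by simp

/-- Unless it vanishes formally along the curve, an analytic function is equivalent to a monomial
along it. -/
theorem exists_tendsto_of_not_isFlat {A : ℕ → Fin 3 → Polynomial ℝ}
    (hA : ∀ N j, (A N j).coeff 0 = 0) {f : R3 → ℝ} (hf : AnalyticAt ℝ f 0) (hfl : ¬ IsFlat A f) :
    ∃ (m : ℕ) (c : ℝ), c ≠ 0 ∧ ∀ (S : Set R3) (u : R3 → ℝ), IsAsymptotic A S u →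
      Tendsto (fun p => f p / u p ^ m) (𝓝[S] 0) (𝓝 c) := by
  unfold IsFlat at hfl
  push Not at hfl
  obtain ⟨N, hN⟩ := hfl
  have hfa : AnalyticAt ℝ (fun s => f (polyCurve A N s)) 0 :=
    AnalyticAt.comp (g := f) (f := polyCurve A N) (by rw [polyCurve_zero hA]; exact hf)
      (analyticAt_toLp_eval (A N) 0)
  -- Since `m < N`, the error `O(u ^ N)` made by replacing `p` with the polynomial curve is
  -- negligible against `u ^ m`.
  obtain ⟨m, k, hm, hk, hk0, hmk⟩ := exists_eq_pow_mul_of_not_isBigO hfa hN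
  refine ⟨m, k 0, hk0, fun S u h => ?_⟩
  have h1 : Tendsto (fun p => k (u p)) (𝓝[S] 0) (𝓝 (k 0)) :=
    hk.continuousAt.tendsto.comp h.tendsto
  have h2 : Tendsto (fun p => (f p - f (polyCurve A N (u p))) / u p ^ m) (𝓝[S] 0) (𝓝 0) := by
    refine ((h.isBigO_sub hA hf N).trans_isLittleO ?_).tendsto_div_nhds_zero
    exact (isLittleO_pow_pow hm).comp_tendsto h.tendsto
  have h3 := h2.add h1
  rw [zero_add] at h3
  refine h3.congr' ?_
  filter_upwards [h.pos, h.tendsto.eventually hmk] with p hp hp'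
  rw [hp']
  have : u p ^ m ≠ 0 := pow_ne_zero _ hp.ne'
  field_simp
  ring

open PowerSeries in
-- Flatness of a coordinate says that `X ^ N` divides the `N`-th polynomial; substituting a series
-- without constant term keeps this divisibility, so `c` is divisible by every power of `X`.
theorem IsFlat.coord_eq_zero {A : ℕ → Fin 3 → Polynomial ℝ} {j : Fin 3}
    (hfl : IsFlat A (fun p => p j)) {c U : PowerSeries ℝ} (hU : constantCoeff U = 0)
    (hcU : ∀ N, (X : PowerSeries ℝ) ^ N ∣ c - Polynomial.aeval U (A N j)) : c = 0 := by
  have h1 : ∀ N, (X : PowerSeries ℝ) ^ N ∣ c := by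
    intro N
    obtain ⟨Q, hQ⟩ : Polynomial.X ^ N ∣ A N j := X_pow_dvd_of_isBigO (hfl N)
    have h2 : (X : PowerSeries ℝ) ^ N ∣ Polynomial.aeval U (A N j) := by
      rw [hQ, map_mul, map_pow, Polynomial.aeval_X]
      exact Dvd.dvd.mul_right (pow_dvd_pow_of_dvd (X_dvd_iff.2 hU) N) _
    simpa using dvd_add (hcU N) h2
  ext k
  simpa using (X_pow_dvd_iff.1 (h1 (k + 1))) k (Nat.lt_succ_self k)

open PowerSeries in
-- This turns a formal congruence into an estimate: after truncating `c` and `U`, it is a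
-- divisibility by `X ^ N` between polynomials, which can be evaluated.
theorem isBigO_trunc_sub {P : Polynomial ℝ} {c U : PowerSeries ℝ} {N : ℕ}
    (hcU : (X : PowerSeries ℝ) ^ N ∣ c - Polynomial.aeval U P) :
    (fun t => (trunc N c).eval t - P.eval ((trunc N U).eval t)) =O[𝓝 0] fun t : ℝ => t ^ N := by
  have htr : ∀ a : PowerSeries ℝ, (X : PowerSeries ℝ) ^ N ∣ (trunc N a : PowerSeries ℝ) - a := by
    intro a
    rw [X_pow_dvd_iff]
    intro m hm
    simp [coeff_trunc, hm]
  have h1 : (X : PowerSeries ℝ) ^ N ∣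
      Polynomial.aeval U P - Polynomial.aeval (trunc N U : PowerSeries ℝ) P := by
    have h2 : U - (trunc N U : PowerSeries ℝ) ∣
        Polynomial.aeval U P - Polynomial.aeval (trunc N U : PowerSeries ℝ) P := by
      rw [Polynomial.aeval_def, Polynomial.aeval_def, ← Polynomial.eval_map,
        ← Polynomial.eval_map]
      exact Polynomial.sub_dvd_eval_sub _ _ _
    refine Dvd.dvd.trans ?_ h2
    rw [← dvd_neg, neg_sub]
    exact htr U
  have h3 : (X : PowerSeries ℝ) ^ N ∣
      ((trunc N c - P.comp (trunc N U) : Polynomial ℝ) : PowerSeries ℝ) := by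
    have h4 : ((P.comp (trunc N U) : Polynomial ℝ) : PowerSeries ℝ) =
        Polynomial.aeval (trunc N U : PowerSeries ℝ) P := by
      have := Polynomial.aeval_algHom_apply (Polynomial.coeToPowerSeries.algHom (R := ℝ) ℝ)
        (trunc N U) P
      simp only [Polynomial.coeToPowerSeries.algHom_apply] at this
      simpa [Polynomial.comp, Polynomial.aeval_def] using this.symm
    have := dvd_add (dvd_add (htr c) hcU) h1
    simpa [h4] using this
  have h5 : Polynomial.X ^ N ∣ trunc N c - P.comp (trunc N U) := by
    rw [Polynomial.X_pow_dvd_iff]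
    intro d hd
    have := X_pow_dvd_iff.1 h3 d hd
    rwa [Polynomial.coeff_coe] at this
  obtain ⟨Q, hQ⟩ := h5
  have h6 : ∀ t, (trunc N c).eval t - P.eval ((trunc N U).eval t) = t ^ N * Q.eval t := by
    intro t
    rw [← Polynomial.eval_comp, ← Polynomial.eval_sub, hQ]
    simp
  simp_rw [h6]
  simpa using (isBigO_refl (fun t : ℝ => t ^ N) (𝓝 0)).mul
    (Q.continuous.continuousAt.tendsto.isBigO_one ℝ)

/-- A function that vanishes formally along the expansion of `C` has a zero composition with
`C`. -/
theorem IsFlat.comp_eq_zero {A : ℕ → Fin 3 → Polynomial ℝ} (hA : ∀ N j, (A N j).coeff 0 = 0)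
    {f : R3 → ℝ} (hf : AnalyticAt ℝ f 0) (hfl : IsFlat A f) (C : FormalCurve) {U : PowerSeries ℝ}
    (hU : PowerSeries.constantCoeff U = 0)
    (hCU : ∀ N j, (PowerSeries.X : PowerSeries ℝ) ^ N ∣
      C.toFun j - Polynomial.aeval U (A N j)) : FormalCurve.comp f C = 0 := by
  ext k
  rw [FormalCurve.comp, PowerSeries.coeff_mk]
  have hj0 : C.jet k 0 = 0 := by
    ext j
    simp [FormalCurve.jet, ← Polynomial.coeff_zero_eq_eval_zero, PowerSeries.coeff_trunc,
      C.constantCoeff_eq_zero]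
  have hja : AnalyticAt ℝ (C.jet k) 0 := analyticAt_toLp_eval _ 0
  have hfa : AnalyticAt ℝ (fun t => f (C.jet k t)) 0 :=
    AnalyticAt.comp (g := f) (f := C.jet k) (by rw [hj0]; exact hf) hja
  rw [iteratedDeriv_eq_zero_of_isBigO hfa, zero_div]
  · simp
  -- The jet of `C` at `t` and the polynomial curve at the parameter `V(t)` agree to order `k + 1`.
  -- As `V(t) = O(t)`, flatness in the parameter gives flatness in `t`.
  set V := PowerSeries.trunc (k + 1) U with hV
  have hV0 : V.eval 0 = 0 := by
    rw [← Polynomial.coeff_zero_eq_eval_zero, hV, PowerSeries.coeff_trunc]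
    simp [hU]
  have hVt : Tendsto (fun t => V.eval t) (𝓝 0) (𝓝 0) := by
    simpa [hV0] using V.continuous.tendsto 0
  have hVO : (fun t => V.eval t) =O[𝓝 0] fun t : ℝ => t := by
    obtain ⟨Q, hQ⟩ : Polynomial.X ∣ V := by
      rw [Polynomial.X_dvd_iff, Polynomial.coeff_zero_eq_eval_zero, hV0]
    rw [hQ]
    simpa using (isBigO_refl (fun t : ℝ => t) (𝓝 0)).mul
      (Q.continuous.continuousAt.tendsto.isBigO_one ℝ)
  have h1 : (fun t => f (C.jet k t) - f (polyCurve A (k + 1) (V.eval t))) =O[𝓝 0]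
      fun t : ℝ => t ^ (k + 1) := by
    refine (isBigO_sub_of_analyticAt hf ?_ ((tendsto_polyCurve hA _).comp hVt)).trans ?_
    · simpa [hj0] using hja.continuousAt.tendsto
    · exact isBigO_euclidean fun j => isBigO_trunc_sub (hCU (k + 1) j)
  have h2 := ((hfl (k + 1)).comp_tendsto hVt).trans (hVO.pow (k + 1))
  exact (h1.add h2).congr_left fun t => by simp

/-! ### Integral curves of autonomous vector fields -/

section ODE

variable {E : Type*} [NormedAddCommGroup E] [NormedSpace ℝ E]

/-- `φ` is a solution in `U` of `y' = ξ y` on the open interval `(α, β)`. -/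
def IsSolution (U : Set E) (ξ : E → E) (α β : ℝ) (φ : ℝ → E) : Prop :=
  ∀ s ∈ Ioo α β, HasDerivAt φ (ξ (φ s)) s ∧ φ s ∈ U

/-- The set of times near which the solutions coincide is open, and relatively closed by continuity
and local uniqueness; the interval is connected. -/
theorem IsSolution.eqOn {U : Set E} {ξ : E → E} (hξ : ∀ p ∈ U, ContDiffAt ℝ 1 ξ p) {α β : ℝ}
    {φ ψ : ℝ → E} (hφ : IsSolution U ξ α β φ) (hψ : IsSolution U ξ α β ψ) {s₀ : ℝ}
    (hs₀ : s₀ ∈ Ioo α β) (h : φ s₀ = ψ s₀) : EqOn φ ψ (Ioo α β) := by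
  have key : ∀ s ∈ Ioo α β, φ s = ψ s → ∀ᶠ x in 𝓝 s, φ x = ψ x := by
    intro s hs he
    obtain ⟨K, t, ht, hK⟩ := (hξ _ (hφ s hs).2).exists_lipschitzOnWith
    have hI : ∀ᶠ x in 𝓝 s, x ∈ Ioo α β := Ioo_mem_nhds hs.1 hs.2
    refine ODE_solution_unique_of_eventually (v := fun _ => ξ) (s := fun _ => t) (K := K)
      (Eventually.of_forall fun _ => hK) ?_ ?_ he
    · filter_upwards [hI, (hφ s hs).1.continuousAt.eventually_mem ht] with x hx hx'
      exact ⟨(hφ x hx).1, hx'⟩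
    · filter_upwards [hI, (hψ s hs).1.continuousAt.eventually_mem (he ▸ ht)] with x hx hx'
      exact ⟨(hψ x hx).1, hx'⟩
  set u := {s | ∀ᶠ x in 𝓝 s, φ x = ψ x} with hu
  have hsub : Ioo α β ⊆ u := by
    refine isPreconnected_Ioo.subset_of_closure_inter_subset isOpen_setOfPred_eventually_nhds
      ⟨s₀, hs₀, key s₀ hs₀ h⟩ ?_
    rintro s ⟨hs, hsI⟩
    refine key s hsI ?_
    have : (𝓝[u] s).NeBot := mem_closure_iff_nhdsWithin_neBot.1 hs
    have h1 : Tendsto φ (𝓝[u] s) (𝓝 (φ s)) := (hφ s hsI).1.continuousAt.mono_left nhdsWithin_le_nhds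
    have h2 : Tendsto ψ (𝓝[u] s) (𝓝 (ψ s)) := (hψ s hsI).1.continuousAt.mono_left nhdsWithin_le_nhds
    refine tendsto_nhds_unique (h1.congr' ?_) h2
    exact eventually_nhdsWithin_of_forall fun x hx =>
      Eventually.self_of_nhds (p := fun y => φ y = ψ y) hx
  exact fun s hs => (hsub hs).self_of_nhds

/-- Two solutions that agree at a point glue. -/
theorem IsSolution.glue {U : Set E} {ξ : E → E} (hξ : ∀ p ∈ U, ContDiffAt ℝ 1 ξ p)
    {α β α' β' : ℝ} {φ φ' : ℝ → E} (hφ : IsSolution U ξ α β φ) (hφ' : IsSolution U ξ α' β' φ')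
    {s₀ : ℝ} (hs₀ : s₀ ∈ Ioo α β) (hs₀' : s₀ ∈ Ioo α' β') (h : φ s₀ = φ' s₀) :
    ∃ ψ, IsSolution U ξ (min α α') (max β β') ψ ∧ EqOn ψ φ (Ioo α β) ∧
      EqOn ψ φ' (Ioo α' β') := by
  classical
  have hint : EqOn φ φ' (Ioo (max α α') (min β β')) := by
    refine IsSolution.eqOn hξ (fun s hs => hφ s ?_) (fun s hs => hφ' s ?_) (s₀ := s₀) ?_ h
    · exact ⟨(le_max_left _ _).trans_lt hs.1, hs.2.trans_le (min_le_left _ _)⟩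
    · exact ⟨(le_max_right _ _).trans_lt hs.1, hs.2.trans_le (min_le_right _ _)⟩
    · exact ⟨max_lt hs₀.1 hs₀'.1, lt_min hs₀.2 hs₀'.2⟩
  set ψ : ℝ → E := fun s => if s ∈ Ioo α β then φ s else φ' s with hψ
  have e1 : EqOn ψ φ (Ioo α β) := fun s hs => by simp only [hψ]; rw [if_pos hs]
  have e2 : EqOn ψ φ' (Ioo α' β') := fun s hs => by
    simp only [hψ]
    split_ifs with hs'
    · exact hint ⟨max_lt hs'.1 hs.1, lt_min hs'.2 hs.2⟩
    · rfl
  refine ⟨ψ, fun s hs => ?_, e1, e2⟩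
  have hcase : s ∈ Ioo α β ∨ s ∈ Ioo α' β' := by
    rcases lt_trichotomy s s₀ with hlt | rfl | hlt
    · rcases min_lt_iff.1 hs.1 with h1 | h1
      · exact Or.inl ⟨h1, hlt.trans hs₀.2⟩
      · exact Or.inr ⟨h1, hlt.trans hs₀'.2⟩
    · exact Or.inl hs₀
    · rcases lt_max_iff.1 hs.2 with h1 | h1
      · exact Or.inl ⟨hs₀.1.trans hlt, h1⟩
      · exact Or.inr ⟨hs₀'.1.trans hlt, h1⟩
  rcases hcase with hs | hs
  · rw [e1 hs]
    exact ⟨(hφ s hs).1.congr_of_eventuallyEq (e1.eventuallyEq_of_mem (Ioo_mem_nhds hs.1 hs.2)),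
      (hφ s hs).2⟩
  · rw [e2 hs]
    exact ⟨(hφ' s hs).1.congr_of_eventuallyEq (e2.eventuallyEq_of_mem (Ioo_mem_nhds hs.1 hs.2)),
      (hφ' s hs).2⟩

variable [CompleteSpace E] {U : Set E} {ξ : E → E} {a b : ℝ} {c : ℝ → E} {l τ : ℝ → ℝ}

/-- A curve tangent to `ξ` is locally a reparameterized solution. -/
theorem exists_local_solution (hU : IsOpen U) (hξ : ∀ p ∈ U, ContDiffAt ℝ 1 ξ p)
    (hc : ∀ t ∈ Ioo a b, HasDerivAt c (l t • ξ (c t)) t) (hcU : ∀ t ∈ Ioo a b, c t ∈ U)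
    (hl : ContinuousOn l (Ioo a b)) (hτ : ∀ t ∈ Ioo a b, HasDerivAt τ (l t) t) {t₀ : ℝ}
    (ht₀ : t₀ ∈ Ioo a b) :
    ∃ (α β : ℝ) (φ : ℝ → E), IsSolution U ξ α β φ ∧
      ∀ᶠ t in 𝓝 t₀, τ t ∈ Ioo α β ∧ c t = φ (τ t) := by
  have hξ0 := hξ _ (hcU t₀ ht₀)
  obtain ⟨φ, hφ0, ε, hε, hφ⟩ :=
    hξ0.exists_forall_mem_closedBall_exists_eq_forall_mem_Ioo_hasDerivAt₀ (τ t₀)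
  have hφc : ContinuousAt φ (τ t₀) := (hφ _ ⟨by linarith, by linarith⟩).continuousAt
  have hφU : ∀ᶠ s in 𝓝 (τ t₀), φ s ∈ U :=
    hφc.eventually_mem (hU.mem_nhds (by rw [hφ0]; exact hcU t₀ ht₀))
  obtain ⟨δ, hδ, hδU⟩ := Metric.eventually_nhds_iff_ball.1 hφU
  rw [Real.ball_eq_Ioo] at hδU
  have hsol : IsSolution U ξ (τ t₀ - min ε δ) (τ t₀ + min ε δ) φ := fun s hs =>
    ⟨hφ s ⟨by linarith [hs.1, min_le_left ε δ], by linarith [hs.2, min_le_left ε δ]⟩,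
      hδU s ⟨by linarith [hs.1, min_le_right ε δ], by linarith [hs.2, min_le_right ε δ]⟩⟩
  have hm : 0 < min ε δ := lt_min hε hδ
  refine ⟨_, _, φ, hsol, ?_⟩
  have hτc : ContinuousAt τ t₀ := (hτ t₀ ht₀).continuousAt
  have hτm : ∀ᶠ t in 𝓝 t₀, τ t ∈ Ioo (τ t₀ - min ε δ) (τ t₀ + min ε δ) :=
    hτc.eventually_mem (Ioo_mem_nhds (by linarith) (by linarith))
  refine hτm.and ?_
  obtain ⟨K, s, hs, hK⟩ := hξ0.exists_lipschitzOnWith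
  have hI : ∀ᶠ t in 𝓝 t₀, t ∈ Ioo a b := Ioo_mem_nhds ht₀.1 ht₀.2
  have hlb : ∀ᶠ t in 𝓝 t₀, ‖l t‖₊ < ‖l t₀‖₊ + 1 :=
    (hl.continuousAt (Ioo_mem_nhds ht₀.1 ht₀.2)).nnnorm.eventually_lt_const
      (lt_add_of_pos_right _ one_pos)
  -- Both `c` and `φ ∘ τ` solve the non-autonomous equation `y' = l(t) ξ(y)` with the same value at
  -- `t₀`.
  refine ODE_solution_unique_of_eventually (v := fun t y => l t • ξ y) (s := fun _ => s)
    (K := (‖l t₀‖₊ + 1) * K) ?_ ?_ ?_ hφ0.symm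
  · filter_upwards [hlb] with t ht
    exact ((lipschitzWith_smul (l t)).comp_lipschitzOnWith hK).weaken
      (mul_le_mul_left ht.le _)
  · filter_upwards [hI, (hc t₀ ht₀).continuousAt.eventually_mem hs] with t ht ht'
    exact ⟨hc t ht, ht'⟩
  · have hcomp : ContinuousAt (fun t => φ (τ t)) t₀ := hφc.comp hτc
    filter_upwards [hI, hτm, hcomp.eventually_mem (by rw [hφ0]; exact hs)] with t ht htm ht'
    exact ⟨(hsol _ htm).1.scomp t (hτ t ht), ht'⟩

/-- A curve tangent to `ξ` is, on compact intervals, a reparameterized solution. -/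
theorem exists_solution_uIcc (hU : IsOpen U) (hξ : ∀ p ∈ U, ContDiffAt ℝ 1 ξ p)
    (hc : ∀ t ∈ Ioo a b, HasDerivAt c (l t • ξ (c t)) t) (hcU : ∀ t ∈ Ioo a b, c t ∈ U)
    (hl : ContinuousOn l (Ioo a b)) (hτ : ∀ t ∈ Ioo a b, HasDerivAt τ (l t) t) {t₁ t₂ : ℝ}
    (ht₁ : t₁ ∈ Ioo a b) (ht₂ : t₂ ∈ Ioo a b) :
    ∃ (α β : ℝ) (φ : ℝ → E), IsSolution U ξ α β φ ∧
      ∀ t ∈ uIcc t₁ t₂, τ t ∈ Ioo α β ∧ c t = φ (τ t) := by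
  -- Lying on a common solution is a relation between times that holds locally, is transitive by
  -- gluing, and is symmetric.
  refine isPreconnected_Ioo.induction₂ (s := Ioo a b) (fun t₁ t₂ => ∃ (α β : ℝ) (φ : ℝ → E),
    IsSolution U ξ α β φ ∧ ∀ t ∈ uIcc t₁ t₂, τ t ∈ Ioo α β ∧ c t = φ (τ t)) ?_ ?_ ?_ ht₁ ht₂
  · intro t ht
    obtain ⟨α, β, φ, hφ, h⟩ := exists_local_solution hU hξ hc hcU hl hτ ht
    obtain ⟨δ, hδ, hball⟩ := Metric.eventually_nhds_iff_ball.1 h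
    refine eventually_nhdsWithin_of_eventually_nhds ?_
    filter_upwards [Metric.ball_mem_nhds t hδ] with t' ht'
    refine ⟨α, β, φ, hφ, fun x hx => hball x ?_⟩
    exact (convex_ball t δ).ordConnected.uIcc_subset (Metric.mem_ball_self hδ) ht' hx
  · rintro x y z - - - ⟨α, β, φ, hφ, h⟩ ⟨α', β', φ', hφ', h'⟩
    have hy := h y right_mem_uIcc
    have hy' := h' y left_mem_uIcc
    obtain ⟨ψ, hψ, e1, e2⟩ := hφ.glue hξ hφ' hy.1 hy'.1 (by rw [← hy.2, ← hy'.2])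
    refine ⟨_, _, ψ, hψ, fun t ht => ?_⟩
    rcases uIcc_subset_uIcc_union_uIcc (b := y) ht with ht | ht
    · have h1 := h t ht
      refine ⟨⟨(min_le_left _ _).trans_lt h1.1.1, h1.1.2.trans_le (le_max_left _ _)⟩, ?_⟩
      rw [e1 h1.1, h1.2]
    · have h1 := h' t ht
      refine ⟨⟨(min_le_right _ _).trans_lt h1.1.1, h1.1.2.trans_le (le_max_right _ _)⟩, ?_⟩
      rw [e2 h1.1, h1.2]
  · rintro x y - - ⟨α, β, φ, hφ, h⟩
    exact ⟨α, β, φ, hφ, fun t ht => h t (by rwa [uIcc_comm])⟩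

/-- A curve tangent to `ξ` is a reparameterized solution. -/
theorem exists_solution_image (hU : IsOpen U) (hξ : ∀ p ∈ U, ContDiffAt ℝ 1 ξ p)
    (hc : ∀ t ∈ Ioo a b, HasDerivAt c (l t • ξ (c t)) t) (hcU : ∀ t ∈ Ioo a b, c t ∈ U)
    (hl : ContinuousOn l (Ioo a b)) (hτ : ∀ t ∈ Ioo a b, HasDerivAt τ (l t) t) :
    ∃ φ : ℝ → E, (∀ t ∈ Ioo a b, c t = φ (τ t)) ∧
      ∀ s ∈ τ '' Ioo a b, HasDerivWithinAt φ (ξ (φ s)) (τ '' Ioo a b) s := by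
  classical
  -- `τ` need not be injective, as `l` may vanish or change sign; nevertheless `c t` depends only on
  -- `τ t`.
  have hwd : ∀ t ∈ Ioo a b, ∀ t' ∈ Ioo a b, τ t = τ t' → c t = c t' := by
    intro t ht t' ht' he
    obtain ⟨α, β, φ, -, h⟩ := exists_solution_uIcc hU hξ hc hcU hl hτ ht ht'
    rw [(h t left_mem_uIcc).2, (h t' right_mem_uIcc).2, he]
  set φ : ℝ → E := fun s => c (Function.invFunOn τ (Ioo a b) s) with hφ
  have hcφ : ∀ t ∈ Ioo a b, c t = φ (τ t) := fun t ht =>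
    hwd t ht _ (Function.invFunOn_mem ⟨t, ht, rfl⟩) (Function.invFunOn_eq ⟨t, ht, rfl⟩).symm
  refine ⟨φ, hcφ, ?_⟩
  intro s hs
  -- A compact time interval is sought whose image under `τ` covers a neighbourhood of `s` in the
  -- whole image. If `s` is an extremity of the image, a time over `s` itself serves on that side,
  -- and the derivative is one-sided.
  have hright : ∃ t ∈ Ioo a b, s ≤ τ t ∧ ∀ᶠ x in 𝓝[τ '' Ioo a b] s, x ≤ τ t := by
    by_cases h : ∃ t ∈ Ioo a b, s < τ t
    · obtain ⟨t, ht, hlt⟩ := h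
      refine ⟨t, ht, hlt.le, eventually_nhdsWithin_of_eventually_nhds ?_⟩
      exact (eventually_lt_nhds hlt).mono fun x hx => hx.le
    · push Not at h
      obtain ⟨t, ht, rfl⟩ := hs
      refine ⟨t, ht, le_rfl, eventually_nhdsWithin_of_forall ?_⟩
      rintro _ ⟨t', ht', rfl⟩
      exact h t' ht'
  have hleft : ∃ t ∈ Ioo a b, τ t ≤ s ∧ ∀ᶠ x in 𝓝[τ '' Ioo a b] s, τ t ≤ x := by
    by_cases h : ∃ t ∈ Ioo a b, τ t < s
    · obtain ⟨t, ht, hlt⟩ := h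
      refine ⟨t, ht, hlt.le, eventually_nhdsWithin_of_eventually_nhds ?_⟩
      exact (eventually_gt_nhds hlt).mono fun x hx => hx.le
    · push Not at h
      obtain ⟨t, ht, rfl⟩ := hs
      refine ⟨t, ht, le_rfl, eventually_nhdsWithin_of_forall ?_⟩
      rintro _ ⟨t', ht', rfl⟩
      exact h t' ht'
  obtain ⟨t₂, ht₂, hst₂, hev₂⟩ := hright
  obtain ⟨t₁, ht₁, hst₁, hev₁⟩ := hleft
  obtain ⟨α, β, ψ, hψ, h⟩ := exists_solution_uIcc hU hξ hc hcU hl hτ ht₁ ht₂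
  have hsub : uIcc t₁ t₂ ⊆ Ioo a b := ordConnected_Ioo.uIcc_subset ht₁ ht₂
  have hτc : ContinuousOn τ (uIcc t₁ t₂) := fun t ht =>
    (hτ t (hsub ht)).continuousAt.continuousWithinAt
  have heq : ∀ x ∈ Icc (τ t₁) (τ t₂), φ x = ψ x ∧ x ∈ Ioo α β := by
    intro x hx
    obtain ⟨t, ht, rfl⟩ := intermediate_value_uIcc hτc (Icc_subset_uIcc hx)
    rw [← hcφ t (hsub ht)]
    exact ⟨(h t ht).2, (h t ht).1⟩
  have hs' := heq s ⟨hst₁, hst₂⟩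
  have hd : HasDerivWithinAt ψ (ξ (φ s)) (τ '' Ioo a b) s := by
    rw [hs'.1]
    exact (hψ s hs'.2).1.hasDerivWithinAt
  refine hd.congr_of_eventuallyEq ?_ hs'.1
  filter_upwards [hev₁, hev₂] with x h1 h2
  exact (heq x ⟨h1, h2⟩).1

end ODE

/-- An integral curve is a reparameterized solution of `y' = ξ y`. -/
theorem IsIntegralCurve.exists_time_change {U : Set R3} (hU : IsOpen U) {ξ : R3 → R3}
    (hξ : ∀ p ∈ U, ContDiffAt ℝ 1 ξ p) {a : ℝ} {c : ℝ → R3} (h : IsIntegralCurve U ξ a c) :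
    ∃ (τ : ℝ → ℝ) (φ : ℝ → R3), ContinuousOn τ (Ioo 0 a) ∧ (∀ t ∈ Ioo 0 a, c t = φ (τ t)) ∧
      ∀ s ∈ τ '' Ioo 0 a, HasDerivWithinAt φ (ξ (φ s)) (τ '' Ioo 0 a) s := by
  have hder : ∀ t ∈ Ioo 0 a, HasDerivAt c (deriv c t) t := fun t ht =>
    ((h.contDiffOn.differentiableOn one_ne_zero).differentiableAt
      (Ioo_mem_nhds ht.1 ht.2)).hasDerivAt
  have hdc : ContinuousOn (deriv c) (Ioo 0 a) :=
    h.contDiffOn.continuousOn_deriv_of_isOpen isOpen_Ioo le_rfl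
  have hξc : ContinuousOn (fun t => ξ (c t)) (Ioo 0 a) := fun t ht =>
    ((hξ _ (h.mem t ht)).continuousAt.comp (hder t ht).continuousAt).continuousWithinAt
  -- Projecting `c'` onto `ξ` yields the proportionality factor as a continuous function, whose
  -- primitive is the time of the flow.
  set l : ℝ → ℝ := fun t => inner ℝ (ξ (c t)) (deriv c t) / ‖ξ (c t)‖ ^ 2 with hl
  have hlc : ContinuousOn l (Ioo 0 a) :=
    (hξc.inner hdc).div (hξc.norm.pow 2) fun t ht => by
      have := h.field_ne_zero t ht
      positivity
  have hcl : ∀ t ∈ Ioo 0 a, HasDerivAt c (l t • ξ (c t)) t := by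
    intro t ht
    obtain ⟨r, hr⟩ := h.tangent t ht
    have hne : ‖ξ (c t)‖ ^ 2 ≠ 0 := by
      have := h.field_ne_zero t ht
      positivity
    have : l t = r := by
      simp only [hl, hr, inner_smul_right, real_inner_self_eq_norm_sq]
      exact mul_div_cancel_right₀ r hne
    rw [this, ← hr]
    exact hder t ht
  set t₀ := a / 2 with ht₀
  have ht₀m : t₀ ∈ Ioo 0 a := ⟨by linarith [h.pos], by linarith [h.pos]⟩
  have hτ : ∀ t ∈ Ioo 0 a, HasDerivAt (fun t => ∫ x in t₀..t, l x) (l t) t := by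
    intro t ht
    refine intervalIntegral.integral_hasDerivAt_right ?_ ?_ ?_
    · exact (hlc.mono (ordConnected_Ioo.uIcc_subset ht₀m ht)).intervalIntegrable
    · exact hlc.stronglyMeasurableAtFilter isOpen_Ioo t ht
    · exact hlc.continuousAt (Ioo_mem_nhds ht.1 ht.2)
  obtain ⟨φ, h1, h2⟩ := exists_solution_image hU hξ hcl h.mem hlc hτ
  exact ⟨_, φ, fun t ht => (hτ t ht).continuousAt.continuousWithinAt, h1, h2⟩

/-! ### Trajectories along which a coordinate is monotone -/

theorem IsIntegralCurve.tendsto_image {U : Set R3} {ξ : R3 → R3} {a : ℝ} {c : ℝ → R3}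
    (h : IsIntegralCurve U ξ a c) : Tendsto c (𝓝[>] 0) (𝓝[c '' Ioo 0 a] 0) := by
  refine tendsto_nhdsWithin_iff.2 ⟨h.tendsto, ?_⟩
  filter_upwards [Ioo_mem_nhdsGT h.pos] with t ht
  exact mem_image_of_mem _ ht

theorem monotoneOn_of_hasDerivWithinAt {J : Set ℝ} (hJ : Convex ℝ J) {f f' : ℝ → ℝ}
    (hf : ∀ s ∈ J, HasDerivWithinAt f (f' s) J s) (h0 : ∀ s ∈ J, 0 ≤ f' s) : MonotoneOn f J :=
  monotoneOn_of_hasDerivWithinAt_nonneg hJ (fun s hs => (hf s hs).continuousWithinAt)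
    (fun s hs => (hf s (interior_subset hs)).mono interior_subset)
    fun s hs => h0 s (interior_subset hs)

theorem strictMonoOn_of_hasDerivWithinAt {J : Set ℝ} (hJ : Convex ℝ J) {f f' : ℝ → ℝ}
    (hf : ∀ s ∈ J, HasDerivWithinAt f (f' s) J s) (h0 : ∀ s ∈ J, 0 < f' s) : StrictMonoOn f J :=
  strictMonoOn_of_hasDerivWithinAt_pos hJ (fun s hs => (hf s hs).continuousWithinAt)
    (fun s hs => (hf s (interior_subset hs)).mono interior_subset)
    fun s hs => h0 s (interior_subset hs)

/-- A positive coordinate `x` that tends to `0` along a trajectory cannot vary too slowly with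
respect to another one. -/
theorem IsIntegralCurve.not_slow {U : Set R3} (hU : IsOpen U) {ξ : R3 → R3}
    (hξ : ∀ p ∈ U, ContDiffAt ℝ 1 ξ p) {a : ℝ} {c : ℝ → R3} (h : IsIntegralCurve U ξ a c)
    (x y : R3 →L[ℝ] ℝ) (hxy : ∀ᶠ p in 𝓝[c '' Ioo 0 a] 0,
      0 < x p ∧ 0 < y (ξ p) ∧ |x (ξ p)| ≤ x p * y (ξ p)) : False := by
  obtain ⟨τ, φ, hτ, hcφ, hφ⟩ := h.exists_time_change hU hξ
  obtain ⟨b, hb, hb'⟩ : ∃ b > 0, ∀ t ∈ Ioo 0 b,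
      t ∈ Ioo 0 a ∧ 0 < x (c t) ∧ 0 < y (ξ (c t)) ∧ |x (ξ (c t))| ≤ x (c t) * y (ξ (c t)) := by
    have := (h.tendsto_image.eventually hxy)
    obtain ⟨b, hb, hb'⟩ := mem_nhdsGT_iff_exists_Ioo_subset.1
      (inter_mem (Ioo_mem_nhdsGT h.pos) this)
    exact ⟨b, hb, fun t ht => hb' ht⟩
  set J := τ '' Ioo 0 b with hJ
  have hsub : Ioo 0 b ⊆ Ioo 0 a := fun t ht => (hb' t ht).1
  have hJc : Convex ℝ J :=
    (isPreconnected_Ioo.image _ (hτ.mono hsub)).ordConnected.convex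
  have hφJ : ∀ s ∈ J, HasDerivWithinAt φ (ξ (φ s)) J s := fun s hs =>
    (hφ s (image_mono hsub hs)).mono (image_mono hsub)
  have hprop : ∀ s ∈ J, 0 < x (φ s) ∧ 0 < y (ξ (φ s)) ∧
      |x (ξ (φ s))| ≤ x (φ s) * y (ξ (φ s)) := by
    rintro _ ⟨t, ht, rfl⟩
    rw [← hcφ t (hsub ht)]
    exact (hb' t ht).2
  have hX : ∀ s ∈ J, HasDerivWithinAt (fun s => Real.log (x (φ s)))
      (x (ξ (φ s)) / x (φ s)) J s := fun s hs =>
    (x.hasFDerivAt.comp_hasDerivWithinAt s (hφJ s hs)).log (hprop s hs).1.ne'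
  have hY : ∀ s ∈ J, HasDerivWithinAt (fun s => y (φ s)) (y (ξ (φ s))) J s := fun s hs =>
    y.hasFDerivAt.comp_hasDerivWithinAt s (hφJ s hs)
  have hle : ∀ s ∈ J, |x (ξ (φ s)) / x (φ s)| ≤ y (ξ (φ s)) := fun s hs => by
    obtain ⟨h1, h2, h3⟩ := hprop s hs
    rw [abs_div, abs_of_pos h1, div_le_iff₀ h1]
    linarith
  -- In the time of the flow, `|(log x)'| ≤ y'`, so `y + log x` and `y - log x` both increase: the
  -- variation of `log x` is at most that of `y`, which is bounded near the origin.
  have m1 : MonotoneOn (fun s => y (φ s) + Real.log (x (φ s))) J :=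
    monotoneOn_of_hasDerivWithinAt hJc (fun s hs => (hY s hs).add (hX s hs)) fun s hs => by
      linarith [neg_abs_le (x (ξ (φ s)) / x (φ s)), hle s hs]
  have m2 : MonotoneOn (fun s => y (φ s) - Real.log (x (φ s))) J :=
    monotoneOn_of_hasDerivWithinAt hJc (fun s hs => (hY s hs).sub (hX s hs)) fun s hs => by
      linarith [le_abs_self (x (ξ (φ s)) / x (φ s)), hle s hs]
  have hkey : ∀ s ∈ J, ∀ s' ∈ J, Real.log (x (φ s)) - |y (φ s) - y (φ s')| ≤
      Real.log (x (φ s')) := by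
    intro s hs s' hs'
    rcases le_total s s' with hss | hss
    · have h2 := m1 hs hs' hss
      have h1 := m2 hs hs' hss
      simp only at h1 h2
      have h3 := neg_abs_le (y (φ s) - y (φ s'))
      linarith
    · have h2 := m1 hs' hs hss
      have h1 := m2 hs' hs hss
      simp only at h1 h2
      have h3 := le_abs_self (y (φ s) - y (φ s'))
      linarith
  set t₀ := b / 2
  have ht₀ : t₀ ∈ Ioo 0 b := ⟨half_pos hb, half_lt_self hb⟩
  have hlog : Tendsto (fun t => Real.log (x (c t))) (𝓝[>] 0) atBot := by
    refine Real.tendsto_log_nhdsGT_zero.comp (tendsto_nhdsWithin_iff.2 ⟨?_, ?_⟩)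
    · exact (x.continuous.tendsto' 0 0 (map_zero x)).comp h.tendsto
    · filter_upwards [Ioo_mem_nhdsGT hb] with t ht
      exact (hb' t ht).2.1
  have hyt : Tendsto (fun t => Real.log (x (c t₀)) - |y (c t₀) - y (c t)|) (𝓝[>] 0)
      (𝓝 (Real.log (x (c t₀)) - |y (c t₀) - 0|)) := by
    have : Tendsto (fun t => y (c t)) (𝓝[>] 0) (𝓝 0) :=
      (y.continuous.tendsto' 0 0 (map_zero y)).comp h.tendsto
    exact (this.const_sub _).abs.const_sub _
  refine not_tendsto_nhds_of_tendsto_atBot (tendsto_atBot_mono' _ ?_ hlog) _ hyt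
  filter_upwards [Ioo_mem_nhdsGT hb] with t ht
  have := hkey _ (mem_image_of_mem τ ht₀) _ (mem_image_of_mem τ ht)
  rwa [← hcφ _ (hsub ht₀), ← hcφ _ (hsub ht)] at this

/-- If the coordinate `x` is positive and increasing with respect to `ξ` along a trajectory near
`0`, the germ of the trajectory is parameterized by `x`. -/
theorem IsIntegralCurve.exists_parameterization {U : Set R3} (hU : IsOpen U) {ξ : R3 → R3}
    (hξ : ∀ p ∈ U, ContDiffAt ℝ 1 ξ p) {a : ℝ} {c : ℝ → R3} (h : IsIntegralCurve U ξ a c)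
    (x : R3 →L[ℝ] ℝ) (ν : ℕ) (K : ℝ)
    (hx : ∀ᶠ p in 𝓝[c '' Ioo 0 a] 0, 0 < x p ∧ 0 < x (ξ p) ∧ ‖p‖ ^ ν ≤ K * x p) :
    ∃ (b : ℝ) (e : ℝ → R3), IsIntegralCurve U ξ b e ∧ (∀ t ∈ Ioo 0 b, x (e t) = t) ∧
      (∀ t ∈ Ioo 0 b, e t ∈ c '' Ioo 0 a) ∧ SameGerm (e '' Ioo 0 b) (c '' Ioo 0 a) := by
  obtain ⟨τ, φ, hτ, hcφ, hφ⟩ := h.exists_time_change hU hξ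
  set J := τ '' Ioo 0 a with hJ
  have hJo : J.OrdConnected := (isPreconnected_Ioo.image _ hτ).ordConnected
  have hφc : ContinuousOn φ J := fun s hs => (hφ s hs).continuousWithinAt
  have hJmem : ∀ s ∈ J, φ s ∈ c '' Ioo 0 a := by
    rintro _ ⟨t, ht, rfl⟩
    exact ⟨t, ht, hcφ t ht⟩
  have himg : ∀ p ∈ c '' Ioo 0 a, ∃ s ∈ J, φ s = p := by
    rintro _ ⟨t, ht, rfl⟩
    exact ⟨τ t, mem_image_of_mem τ ht, (hcφ t ht).symm⟩
  obtain ⟨ε, hε, hball⟩ := Metric.mem_nhdsWithin_iff.1 hx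
  have hb : ∀ s ∈ J, ‖φ s‖ < ε →
      0 < x (φ s) ∧ 0 < x (ξ (φ s)) ∧ ‖φ s‖ ^ ν ≤ K * x (φ s) := fun s hs hs' =>
    hball ⟨mem_ball_zero_iff.2 hs', hJmem s hs⟩
  have hg : ∀ s ∈ J, HasDerivWithinAt (fun s => x (φ s)) (x (ξ (φ s))) J s := fun s hs =>
    x.hasFDerivAt.comp_hasDerivWithinAt s (hφ s hs)
  -- The threshold `ρ` creates a barrier: a point of the trajectory in the `ε`-ball with `x < ρ` is
  -- already in the `ε / 2`-ball.
  obtain ⟨ρ, hρ, hρK⟩ : ∃ ρ > 0, ∀ y < ρ, 0 < y → K * y < (ε / 2) ^ ν := by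
    have h1 : Tendsto (fun y : ℝ => K * y) (𝓝 0) (𝓝 0) := by
      simpa using (continuous_const_mul K).tendsto 0
    obtain ⟨ρ, hρ, h2⟩ := Metric.eventually_nhds_iff.1
      (h1.eventually_lt_const (show (0 : ℝ) < (ε / 2) ^ ν by positivity))
    refine ⟨ρ, hρ, fun y hy hy0 => h2 ?_⟩
    simpa [abs_of_pos hy0] using hy
  have hsmall : ∀ s ∈ J, ‖φ s‖ < ε → x (φ s) < ρ → ‖φ s‖ < ε / 2 := by
    intro s hs h1 h2
    obtain ⟨h3, -, h4⟩ := hb s hs h1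
    exact lt_of_pow_lt_pow_left₀ ν (by positivity) (h4.trans_lt (hρK _ h2 h3))
  have hmono : ∀ s₁ ∈ J, ∀ s₂ ∈ J, (∀ s ∈ Icc s₁ s₂, ‖φ s‖ < ε) →
      StrictMonoOn (fun s => x (φ s)) (Icc s₁ s₂) := by
    intro s₁ hs₁ s₂ hs₂ hs
    have hsub : Icc s₁ s₂ ⊆ J := hJo.out hs₁ hs₂
    exact strictMonoOn_of_hasDerivWithinAt (convex_Icc _ _)
      (fun s hs' => (hg s (hsub hs')).mono hsub) fun s hs' => (hb s (hsub hs') (hs s hs')).2.1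
  -- Going back in time, `x` decreases and stays below `ρ`, so the barrier prevents the solution
  -- from leaving the ball; otherwise the last time `m` outside contradicts continuity.
  have hback : ∀ s₁ ∈ J, ‖φ s₁‖ < ε → x (φ s₁) < ρ → ∀ s ∈ J, s ≤ s₁ → ‖φ s‖ < ε := by
    intro s₁ hs₁ h1 h2 s hs hss
    by_contra! hc
    have hsub : Icc s s₁ ⊆ J := hJo.out hs hs₁
    set Z := {r ∈ Icc s s₁ | ε ≤ ‖φ r‖} with hZ
    have hZc : IsCompact Z := by
      have : IsClosed Z := (hφc.mono hsub).norm.preimage_isClosed_of_isClosed isClosed_Icc isClosed_Ici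
      exact isCompact_Icc.of_isClosed_subset this fun r hr => hr.1
    obtain ⟨m, hm, hmax⟩ := hZc.exists_isGreatest ⟨s, ⟨le_rfl, hss⟩, hc⟩
    have hmlt : m < s₁ := lt_of_le_of_ne hm.1.2 fun he => by
      have := hm.2
      rw [he] at this
      linarith
    have hafter : ∀ r ∈ Ioc m s₁, ‖φ r‖ < ε := fun r hr => by
      by_contra! hr'
      exact absurd (hmax ⟨⟨hm.1.1.trans hr.1.le, hr.2⟩, hr'⟩) (not_le.2 hr.1)
    have hafter' : ∀ r ∈ Ioc m s₁, ‖φ r‖ < ε / 2 := fun r hr => by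
      have hrJ : r ∈ J := hsub ⟨hm.1.1.trans hr.1.le, hr.2⟩
      refine hsmall r hrJ (hafter r hr) (lt_of_le_of_lt ?_ h2)
      exact (hmono r hrJ s₁ hs₁ fun r' hr' => hafter r' ⟨hr.1.trans_le hr'.1, hr'.2⟩).monotoneOn
        ⟨le_rfl, hr.2⟩ ⟨hr.2, le_rfl⟩ hr.2
    have hlim : Tendsto (fun r => ‖φ r‖) (𝓝[Ioc m s₁] m) (𝓝 ‖φ m‖) :=
      ((hφc m (hsub hm.1)).mono
        (fun r hr => hsub ⟨hm.1.1.trans hr.1.le, hr.2⟩)).norm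
    have : (𝓝[Ioc m s₁] m).NeBot := by
      rw [nhdsWithin_Ioc_eq_nhdsGT hmlt]
      infer_instance
    have hle : ‖φ m‖ ≤ ε / 2 :=
      le_of_tendsto hlim (eventually_nhdsWithin_of_forall fun r hr => (hafter' r hr).le)
    linarith [hm.2]
  have hsmallt : ∀ r > 0, ∃ s ∈ J, ‖φ s‖ < ε ∧ x (φ s) < r := by
    intro r hr
    have h1 : ∀ᶠ p in 𝓝 (0 : R3), ‖p‖ < ε ∧ x p < r :=
      (continuous_norm.tendsto' (0 : R3) 0 norm_zero |>.eventually_lt_const hε).and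
        ((x.continuous.tendsto' 0 0 (map_zero x)).eventually_lt_const hr)
    obtain ⟨t, ht, ht'⟩ := ((h.tendsto.eventually h1).and (Ioo_mem_nhdsGT h.pos)).exists
    refine ⟨τ t, mem_image_of_mem τ ht', ?_⟩
    rw [← hcφ t ht']
    exact ht
  obtain ⟨s₁, hs₁, hs₁ε, hs₁ρ⟩ := hsmallt ρ hρ
  set J₁ := {s ∈ J | s ≤ s₁} with hJ₁
  have hJ₁ε : ∀ s ∈ J₁, ‖φ s‖ < ε := fun s hs => hback s₁ hs₁ hs₁ε hs₁ρ s hs.1 hs.2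
  have hg₁ : StrictMonoOn (fun s => x (φ s)) J₁ := by
    intro s hs s' hs' hss
    exact hmono s hs.1 s' hs'.1
      (fun r hr => hJ₁ε r ⟨hJo.out hs.1 hs'.1 hr, hr.2.trans hs'.2⟩)
      ⟨le_rfl, hss.le⟩ ⟨hss.le, le_rfl⟩ hss
  set b := x (φ s₁) with hbdef
  have hb0 : 0 < b := (hb s₁ hs₁ hs₁ε).1
  -- Points with `x` below both `b` and `ρ` must precede `s₁`: a later one would be joined to `s₁`
  -- inside the ball, where `x` increases. So the approach to `0` takes place in `J₁`, where `x ∘ φ`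
  -- is injective.
  have hlow : ∀ r > 0, ∃ s ∈ J₁, x (φ s) < r := by
    intro r hr
    obtain ⟨s, hs, hsε, hsr⟩ := hsmallt (min r (min b ρ)) (by positivity)
    refine ⟨s, ⟨hs, ?_⟩, hsr.trans_le (min_le_left _ _)⟩
    by_contra! hlt
    have hsρ : x (φ s) < ρ := hsr.trans_le ((min_le_right _ _).trans (min_le_right _ _))
    have := (hmono s₁ hs₁ s hs fun r hr =>
      hback s hs hsε hsρ r (hJo.out hs₁ hs hr) hr.2) ⟨le_rfl, hlt.le⟩ ⟨hlt.le, le_rfl⟩ hlt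
    have h2 : x (φ s) < b := hsr.trans_le ((min_le_right _ _).trans (min_le_left _ _))
    simp only at this
    linarith
  have hsurj : ∀ r ∈ Ioo 0 b, ∃ s ∈ J₁, x (φ s) = r := by
    intro r hr
    obtain ⟨s, hs, hsr⟩ := hlow r hr.1
    have hsub : Icc s s₁ ⊆ J := hJo.out hs.1 hs₁
    obtain ⟨s', hs', he⟩ := intermediate_value_Icc hs.2
      ((x.continuous.comp_continuousOn hφc).mono hsub) ⟨hsr.le, hr.2.le⟩
    exact ⟨s', ⟨hsub hs', hs'.2⟩, he⟩
  choose! G hG hGx using hsurj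
  have hGlt : ∀ r ∈ Ioo 0 b, G r < s₁ := fun r hr =>
    lt_of_le_of_ne (hG r hr).2 fun he => by
      have := hGx r hr
      rw [he] at this
      exact absurd this.symm (by rw [← hbdef]; exact hr.2.ne)
  have hGmono : StrictMonoOn G (Ioo 0 b) := by
    intro r hr r' hr' hlt
    by_contra! hc
    have := hg₁.monotoneOn (hG r' hr') (hG r hr) hc
    simp only [hGx r hr, hGx r' hr'] at this
    linarith
  have hJnhds : ∀ r ∈ Ioo 0 b, J₁ ∈ 𝓝 (G r) ∧ G '' Ioo 0 b ∈ 𝓝 (G r) := by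
    intro r hr
    obtain ⟨s, hs, hsr⟩ := hlow r hr.1
    have hlt : s < G r := by
      by_contra! hc
      have := hg₁.monotoneOn (hG r hr) hs hc
      simp only [hGx r hr] at this
      linarith
    have hI : Ioo s s₁ ∈ 𝓝 (G r) := Ioo_mem_nhds hlt (hGlt r hr)
    have hsub : Icc s s₁ ⊆ J := hJo.out hs.1 hs₁
    refine ⟨mem_of_superset hI fun s' hs' => ⟨hsub ⟨hs'.1.le, hs'.2.le⟩, hs'.2.le⟩,
      mem_of_superset hI fun s' hs' => ?_⟩
    have hs'₁ : s' ∈ J₁ := ⟨hsub ⟨hs'.1.le, hs'.2.le⟩, hs'.2.le⟩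
    have hmem : x (φ s') ∈ Ioo 0 b :=
      ⟨(hb s' hs'₁.1 (hJ₁ε s' hs'₁)).1, hg₁ hs'₁ ⟨hs₁, le_rfl⟩ hs'.2⟩
    exact ⟨_, hmem, hg₁.injOn (hG _ hmem) hs'₁ (hGx _ hmem)⟩
  have hGc : ∀ r ∈ Ioo 0 b, ContinuousAt G r := fun r hr =>
    hGmono.continuousAt_of_image_mem_nhds (Ioo_mem_nhds hr.1 hr.2) (hJnhds r hr).2
  have hφd : ∀ r ∈ Ioo 0 b, HasDerivAt φ (ξ (φ (G r))) (G r) := fun r hr =>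
    (hφ _ (hG r hr).1).hasDerivAt (mem_of_superset (hJnhds r hr).1 fun s hs => hs.1)
  have hpos : ∀ r ∈ Ioo 0 b, 0 < x (ξ (φ (G r))) := fun r hr =>
    (hb _ (hG r hr).1 (hJ₁ε _ (hG r hr))).2.1
  have hGd : ∀ r ∈ Ioo 0 b, HasDerivAt G (x (ξ (φ (G r))))⁻¹ r := fun r hr =>
    HasDerivAt.of_local_left_inverse (f := fun s => x (φ s)) (hGc r hr)
      (x.hasFDerivAt.comp_hasDerivAt (G r) (hφd r hr)) (hpos r hr).ne'
      (by filter_upwards [Ioo_mem_nhds hr.1 hr.2] with r' hr' using hGx r' hr')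
  have hed : ∀ r ∈ Ioo 0 b,
      HasDerivAt (fun r => φ (G r)) ((x (ξ (φ (G r))))⁻¹ • ξ (φ (G r))) r := fun r hr =>
    (hφd r hr).scomp r (hGd r hr)
  have heΓ : ∀ r ∈ Ioo 0 b, φ (G r) ∈ c '' Ioo 0 a := fun r hr => hJmem _ (hG r hr).1
  have heU : ∀ r ∈ Ioo 0 b, φ (G r) ∈ U := fun r hr => by
    obtain ⟨t, ht, he⟩ := heΓ r hr
    rw [← he]; exact h.mem t ht
  refine ⟨b, fun r => φ (G r), ⟨hb0, ?_, heU, ?_, ?_, ?_, ?_⟩, hGx, heΓ, ?_⟩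
  · have hξc : ContinuousOn (fun r => ξ (φ (G r))) (Ioo 0 b) := fun r hr =>
      (ContinuousAt.comp (g := ξ) (f := fun r => φ (G r)) (hξ _ (heU r hr)).continuousAt
        (hed r hr).continuousAt).continuousWithinAt
    rw [show (1 : WithTop ℕ∞) = 0 + 1 by simp, contDiffOn_succ_iff_deriv_of_isOpen isOpen_Ioo]
    refine ⟨fun r hr => (hed r hr).differentiableAt.differentiableWithinAt, by simp, ?_⟩
    rw [contDiffOn_zero]
    refine ContinuousOn.congr ?_ fun r hr => (hed r hr).deriv
    exact ((x.continuous.comp_continuousOn hξc).inv₀ fun r hr => (hpos r hr).ne').smul hξc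
  · intro r hr
    obtain ⟨t, ht, he⟩ := heΓ r hr
    rw [← he]; exact h.ne_zero t ht
  · have h1 : Tendsto (fun r : ℝ => K * r) (𝓝[>] 0) (𝓝 0) := by
      simpa using ((continuous_const_mul K).tendsto 0).mono_left nhdsWithin_le_nhds
    have h2 : Tendsto (fun r => ‖φ (G r)‖ ^ ν) (𝓝[>] 0) (𝓝 0) := by
      refine squeeze_zero' (Eventually.of_forall fun r => by positivity) ?_ h1
      filter_upwards [Ioo_mem_nhdsGT hb0] with r hr
      have := (hb _ (hG r hr).1 (hJ₁ε _ (hG r hr))).2.2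
      rwa [hGx r hr] at this
    rw [tendsto_zero_iff_norm_tendsto_zero]
    rw [Metric.tendsto_nhds] at h2 ⊢
    intro η hη
    filter_upwards [h2 (η ^ ν) (by positivity)] with r hr
    simp only [dist_zero_right, norm_pow, norm_norm] at hr ⊢
    exact lt_of_pow_lt_pow_left₀ ν hη.le hr
  · intro r hr
    obtain ⟨t, ht, he⟩ := heΓ r hr
    rw [← he]; exact h.field_ne_zero t ht
  · intro r hr
    exact ⟨_, (hed r hr).deriv⟩
  · have h1 : ∀ᶠ p in 𝓝 (0 : R3), ‖p‖ < ε ∧ x p < min b ρ :=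
      (continuous_norm.tendsto' (0 : R3) 0 norm_zero |>.eventually_lt_const hε).and
        ((x.continuous.tendsto' 0 0 (map_zero x)).eventually_lt_const (lt_min hb0 hρ))
    filter_upwards [h1] with p hp
    constructor
    · rintro ⟨r, hr, rfl⟩
      exact heΓ r hr
    · intro hpΓ
      obtain ⟨s, hs, rfl⟩ := himg p hpΓ
      have hsρ : x (φ s) < ρ := hp.2.trans_le (min_le_right _ _)
      have hsb : x (φ s) < b := hp.2.trans_le (min_le_left _ _)
      have hss : s ≤ s₁ := by
        by_contra! hlt
        have := (hmono s₁ hs₁ s hs fun r hr =>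
          hback s hs hp.1 hsρ r (hJo.out hs₁ hs hr) hr.2) ⟨le_rfl, hlt.le⟩ ⟨hlt.le, le_rfl⟩ hlt
        simp only at this
        linarith
      have hmem : x (φ s) ∈ Ioo 0 b := ⟨(hb s hs hp.1).1, hsb⟩
      refine ⟨_, hmem, ?_⟩
      exact congrArg φ (hg₁.injOn (hG _ hmem) ⟨hs, hss⟩ (hGx _ hmem))

/-! ### Linear charts -/

/-- The linear map `p ↦ (σ pᵢ, ...)`, whose other components are the other coordinates. -/
def coordMap (i : Fin 3) (σ : ℝ) : R3 →L[ℝ] R3 :=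
  LinearMap.toContinuousLinearMap
    { toFun := fun p => WithLp.toLp 2 fun k => (if k = 0 then σ else 1) * p (Equiv.swap 0 i k)
      map_add' := fun p p' => by ext k; simp [mul_add]
      map_smul' := fun r p => by ext k; simp [mul_left_comm] }

theorem coordMap_apply (i : Fin 3) (σ : ℝ) (p : R3) (k : Fin 3) :
    coordMap i σ p k = (if k = 0 then σ else 1) * p (Equiv.swap 0 i k) := rfl

theorem coordMap_apply_zero (i : Fin 3) (σ : ℝ) (p : R3) : coordMap i σ p 0 = σ * p i := by
  rw [coordMap_apply, if_pos rfl, Equiv.swap_apply_left]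

theorem coordMap_bijective (i : Fin 3) {σ : ℝ} (hσ : σ ≠ 0) :
    Function.Bijective (coordMap i σ) := by
  have hinj : Function.Injective (coordMap i σ) := by
    intro p p' h
    ext k
    have h1 := congrArg (fun r : R3 => r (Equiv.swap 0 i k)) h
    simp only [coordMap_apply, Equiv.swap_apply_self] at h1
    refine mul_left_cancel₀ ?_ h1
    split_ifs
    · exact hσ
    · exact one_ne_zero
  exact ⟨hinj, (LinearMap.injective_iff_surjective (f := (coordMap i σ).toLinearMap)).1 hinj⟩

open FirstOrder Language in
theorem anDefinable_mul_eq {α : Type} (r : ℝ) (i j : α) :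
    AnDefinable {w : α → ℝ | r * w i = w j} := by
  refine Set.Definable.mono (A := ∅) ?_ (empty_subset _)
  rw [Set.empty_definable_iff]
  -- Real constants are symbols of arity zero; the cube `[-1,1]⁰` is the whole space, so the value
  -- is not cut off.
  let cst : anLanguage.Term α :=
    Term.func (AnFunctions.restricted (n := 0) (fun _ => r) (fun _ _ => analyticAt_const)) ![]
  let mulT : anLanguage.Term α := Term.func AnFunctions.mul ![cst, Term.var i]
  refine ⟨mulT.equal (Term.var j), ?_⟩
  ext w
  have h1 : cst.realize w = r := if_pos ⟨fun k => k.elim0, fun k => k.elim0⟩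
  have h2 : mulT.realize w = r * w i := by
    rw [← h1]
    rfl
  change _ ↔ (mulT.equal (Term.var j)).Realize w
  rw [Formula.realize_equal, h2]
  rfl

/-- The chart of `ℝ³` given by `coordMap`. -/
def coordChart (i : Fin 3) (σ : ℝ) (hσ : σ ≠ 0) : Chart where
  V := univ
  X := coordMap i σ
  isOpen := isOpen_univ
  zero_mem_closure := by simp
  definable_domain := by
    simp only [mem_univ, ofPred_true]
    exact Set.definable_univ
  definable_map := by
    have : {w : Fin 3 ⊕ Fin 3 → ℝ | WithLp.toLp 2 (w ∘ Sum.inl) ∈ (univ : Set R3) ∧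
        coordMap i σ (WithLp.toLp 2 (w ∘ Sum.inl)) = WithLp.toLp 2 (w ∘ Sum.inr)} =
        ⋂ k : Fin 3, {w | (if k = 0 then σ else 1) * w (Sum.inl (Equiv.swap 0 i k)) =
          w (Sum.inr k)} := by
      ext w
      simp only [mem_univ, true_and, mem_ofPred_eq, mem_iInter]
      constructor
      · intro h k
        exact congrArg (fun p : R3 => p k) h
      · intro h
        ext k
        exact h k
    rw [this]
    exact Set.definable_iInter_of_finite fun k => anDefinable_mul_eq _ _ _
  contDiffOn := (coordMap i σ).contDiff.contDiffOn
  injOn := (coordMap_bijective i hσ).1.injOn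
  bijective_fderiv := fun p _ => by
    rw [ContinuousLinearMap.fderiv]
    exact coordMap_bijective i hσ
  tendsto := ((coordMap i σ).continuous.tendsto' 0 0 (map_zero _)).mono_left nhdsWithin_le_nhds

theorem coordChart_isAnalytic (i : Fin 3) (σ : ℝ) (hσ : σ ≠ 0) :
    (coordChart i σ hσ).IsAnalytic :=
  ⟨mem_univ _, fun p _ => (coordMap i σ).analyticAt p⟩

/-! ### Flat contact of curves with the same expansion -/

/-- A polynomial equivalent to `a u ^ ν` with `a > 0` has a derivative of size `u ^ (ν - 1)`. -/
theorem exists_derivative_lower_bound {g : Polynomial ℝ} {α : Type*} {F : Filter α} [F.NeBot]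
    {u : α → ℝ} (hu : Tendsto u F (𝓝 0)) (hu0 : ∀ᶠ t in F, 0 < u t) {ν : ℕ} (hν : ν ≠ 0) {a : ℝ}
    (ha : 0 < a) (hg : Tendsto (fun t => g.eval (u t) / u t ^ ν) F (𝓝 a)) :
    ∃ κ > 0, ∃ ρ > 0, ∀ s, 0 < s → s < ρ → κ * s ^ (ν - 1) ≤ g.derivative.eval s := by
  have hg0 : g ≠ 0 := by
    rintro rfl
    simp only [Polynomial.eval_zero, zero_div] at hg
    exact ha.ne (tendsto_nhds_unique tendsto_const_nhds hg)
  obtain ⟨Q, hQ, hQ0⟩ := Polynomial.exists_eq_pow_rootMultiplicity_mul_and_not_dvd g hg0 0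
  simp only [map_zero, sub_zero] at hQ hQ0
  rw [Polynomial.X_dvd_iff, Polynomial.coeff_zero_eq_eval_zero] at hQ0
  set m := g.rootMultiplicity 0
  have hge : ∀ s, g.eval s = s ^ m * Q.eval s := fun s => by
    conv_lhs => rw [hQ]
    simp
  have hQt : Tendsto (fun t => Q.eval (u t)) F (𝓝 (Q.eval 0)) :=
    (Q.continuous.tendsto 0).comp hu
  -- The order of the polynomial `g` at `0` must be the exponent `ν` of the equivalent, as any other
  -- order would make one of the limits `Q(0)` and `a` vanish.
  have hmν : m = ν := by
    rcases lt_trichotomy m ν with hlt | he | hlt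
    · exfalso
      have h1 : Tendsto (fun t => g.eval (u t) / u t ^ ν * u t ^ (ν - m)) F (𝓝 (a * 0)) := by
        have := (hu.pow (ν - m))
        rw [zero_pow (by omega)] at this
        exact hg.mul this
      rw [mul_zero] at h1
      refine hQ0 (tendsto_nhds_unique (hQt.congr' ?_) h1)
      filter_upwards [hu0] with t ht
      rw [hge]
      have : u t ^ ν = u t ^ m * u t ^ (ν - m) := by rw [← pow_add]; congr 1; omega
      rw [this]
      field_simp
    · exact he
    · exfalso
      have h1 : Tendsto (fun t => u t ^ (m - ν) * Q.eval (u t)) F (𝓝 (0 * Q.eval 0)) := by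
        have := (hu.pow (m - ν))
        rw [zero_pow (by omega)] at this
        exact this.mul hQt
      rw [zero_mul] at h1
      refine ha.ne (tendsto_nhds_unique (h1.congr' ?_) hg)
      filter_upwards [hu0] with t ht
      rw [hge]
      have : u t ^ m = u t ^ ν * u t ^ (m - ν) := by rw [← pow_add]; congr 1; omega
      rw [this]
      field_simp
  rw [hmν] at hQ hge
  have hQa : Q.eval 0 = a := by
    refine tendsto_nhds_unique (hQt.congr' ?_) hg
    filter_upwards [hu0] with t ht
    rw [hge]
    field_simp
  obtain ⟨n, rfl⟩ := Nat.exists_eq_succ_of_ne_zero hν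
  set T : Polynomial ℝ := Polynomial.C ((n + 1 : ℕ) : ℝ) * Q + Polynomial.X * Q.derivative
  have hT0 : 0 < T.eval 0 := by
    simp only [T, Polynomial.eval_add, Polynomial.eval_mul, Polynomial.eval_C, Polynomial.eval_X,
      zero_mul, add_zero, hQa]
    positivity
  have hder : ∀ s, g.derivative.eval s = s ^ n * T.eval s := by
    intro s
    rw [hQ]
    simp [T]
    ring
  obtain ⟨ρ, hρ, h⟩ := Metric.eventually_nhds_iff.1
    ((T.continuous.tendsto 0).eventually_const_lt (half_lt_self hT0))
  refine ⟨T.eval 0 / 2, half_pos hT0, ρ, hρ, fun s hs hs' => ?_⟩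
  rw [hder, Nat.succ_sub_one, mul_comm]
  exact mul_le_mul_of_nonneg_left (h (by simpa [abs_of_pos hs] using hs')).le (by positivity)

/-- Eventually `a / 2 * u ^ ν < x < 3 / 2 * a * v ^ ν`, whence `u ^ ν ≤ 3 * v ^ ν ≤ (3 * v) ^ ν`. -/
theorem eventually_le_three_mul {α : Type*} {F : Filter α} {x u v : α → ℝ} {ν : ℕ} (hν : ν ≠ 0)
    {a : ℝ} (ha : 0 < a) (hu0 : ∀ᶠ t in F, 0 < u t) (hv0 : ∀ᶠ t in F, 0 < v t)
    (hu : Tendsto (fun t => x t / u t ^ ν) F (𝓝 a))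
    (hv : Tendsto (fun t => x t / v t ^ ν) F (𝓝 a)) : ∀ᶠ t in F, u t ≤ 3 * v t := by
  filter_upwards [hu0, hv0, hu.eventually_const_lt (show a / 2 < a by linarith),
    hv.eventually_lt_const (show a < 3 / 2 * a by linarith)] with t h1 h2 h3 h4
  rw [lt_div_iff₀ (by positivity)] at h3
  rw [div_lt_iff₀ (by positivity)] at h4
  have h5 : u t ^ ν ≤ 3 * v t ^ ν := by
    by_contra! hc
    have := mul_lt_mul_of_pos_left hc (half_pos ha)
    nlinarith
  have h6 : (3 : ℝ) * v t ^ ν ≤ (3 * v t) ^ ν := by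
    rw [mul_pow]
    refine mul_le_mul_of_nonneg_right ?_ (by positivity)
    exact le_self_pow₀ (by norm_num) hν
  exact le_of_pow_le_pow_left₀ hν (by positivity) (h5.trans h6)

theorem isBigO_eval_sub {α : Type*} {F : Filter α} (P : Polynomial ℝ) {u v : α → ℝ}
    (hu : Tendsto u F (𝓝 0)) (hv : Tendsto v F (𝓝 0)) :
    (fun t => P.eval (u t) - P.eval (v t)) =O[F] fun t => u t - v t :=
  ((P.hasStrictDerivAt 0).hasStrictFDerivAt.isBigO_sub).comp_tendsto (hu.prodMk_nhds hv)

/-- If `g (u)` and `g (v)` are close, with `g (s) ~ a s ^ ν`, then `u` and `v` are close. -/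
theorem isBigO_sub_of_eval {α : Type*} {F : Filter α} [F.NeBot] {g : Polynomial ℝ}
    {x u v : α → ℝ} {ν : ℕ} (hν : ν ≠ 0) {a : ℝ} (ha : 0 < a) (hut : Tendsto u F (𝓝 0))
    (hu0 : ∀ᶠ t in F, 0 < u t) (hv0 : ∀ᶠ t in F, 0 < v t)
    (hu : Tendsto (fun t => x t / u t ^ ν) F (𝓝 a))
    (hv : Tendsto (fun t => x t / v t ^ ν) F (𝓝 a)) {M : ℕ}
    (hgu : (fun t => x t - g.eval (u t)) =O[F] fun t => u t ^ (M + ν))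
    (hgv : (fun t => x t - g.eval (v t)) =O[F] fun t => v t ^ (M + ν)) (hM : M ≠ 0) :
    (fun t => u t - v t) =O[F] fun t => u t ^ M := by
  have huv := eventually_le_three_mul hν ha hu0 hv0 hu hv
  have hvu := eventually_le_three_mul hν ha hv0 hu0 hv hu
  have hvO : v =O[F] u := by
    refine IsBigO.of_bound 3 ?_
    filter_upwards [hu0, hv0, hvu] with t h1 h2 h3
    rwa [Real.norm_of_nonneg h1.le, Real.norm_of_nonneg h2.le]
  have hga : Tendsto (fun t => g.eval (u t) / u t ^ ν) F (𝓝 a) := by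
    have h1 : Tendsto (fun t => (x t - g.eval (u t)) / u t ^ ν) F (𝓝 0) := by
      refine (hgu.trans_isLittleO ?_).tendsto_div_nhds_zero
      exact (isLittleO_pow_pow (show ν < M + ν by omega)).comp_tendsto hut
    have h2 := hu.sub h1
    rw [sub_zero] at h2
    exact h2.congr fun t => by ring
  obtain ⟨κ, hκ, ρ, hρ, hd⟩ := exists_derivative_lower_bound hut hu0 hν ha hga
  have hg : (fun t => g.eval (u t) - g.eval (v t)) =O[F] fun t => u t ^ (M + ν) :=
    ((hgv.trans (hvO.pow _)).sub hgu).congr_left fun t => by ring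
  obtain ⟨K, hK⟩ := hg.bound
  refine IsBigO.of_bound (K * 3 ^ ν / κ) ?_
  filter_upwards [hK, hu0, hv0, huv, hvu, hut.eventually_lt_const (show 0 < min (ρ / 3) 1 by
    positivity)] with t hKt h1 h2 h3 h4 h5
  have h5' : 3 * u t < ρ := by
    have := h5.trans_le (min_le_left _ _)
    linarith
  have h5'' : u t < 1 := h5.trans_le (min_le_right _ _)
  -- Both parameters lie in `[u / 3, 3 * u]`, where `g' ≥ B`. The mean value inequality then costs
  -- `ν - 1` powers of `u`, covered by the exponent `M + ν`.
  set B := κ * (u t / 3) ^ (ν - 1)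
  have hB : 0 < B := by positivity
  have hmv : ∀ s ∈ Icc (u t / 3) (3 * u t), ∀ s' ∈ Icc (u t / 3) (3 * u t), s ≤ s' →
      B * (s' - s) ≤ g.eval s' - g.eval s := by
    refine (convex_Icc _ _).mul_sub_le_image_sub_of_le_deriv g.continuous.continuousOn
      g.differentiable.differentiableOn fun s hs => ?_
    have hs' := interior_subset hs
    rw [Polynomial.deriv]
    have hs0 : 0 < s := by linarith [hs'.1]
    refine le_trans ?_ (hd s hs0 (hs'.2.trans_lt h5'))
    refine mul_le_mul_of_nonneg_left ?_ hκ.le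
    exact pow_le_pow_left₀ (by positivity) hs'.1 _
  have hum : u t ∈ Icc (u t / 3) (3 * u t) := ⟨by linarith, by linarith⟩
  have hvm : v t ∈ Icc (u t / 3) (3 * u t) := ⟨by linarith, by linarith⟩
  have habs : B * |u t - v t| ≤ |g.eval (u t) - g.eval (v t)| := by
    rcases le_total (u t) (v t) with hle | hle
    · have := hmv _ hum _ hvm hle
      rw [abs_of_nonpos (by linarith), abs_sub_comm]
      refine le_trans ?_ (le_abs_self _)
      linarith
    · have := hmv _ hvm _ hum hle
      rw [abs_of_nonneg (by linarith)]
      exact this.trans (le_abs_self _)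
  rw [Real.norm_eq_abs, Real.norm_of_nonneg (by positivity)] at hKt
  rw [Real.norm_eq_abs, Real.norm_of_nonneg (by positivity), div_mul_eq_mul_div,
    le_div_iff₀ hκ]
  have hsplit : B * 3 ^ (ν - 1) = κ * u t ^ (ν - 1) := by
    simp only [B]
    rw [div_pow]
    field_simp
  have h6 : κ * u t ^ (ν - 1) * |u t - v t| ≤ K * u t ^ (M + ν) * 3 ^ (ν - 1) := by
    rw [← hsplit]
    have := mul_le_mul_of_nonneg_right (habs.trans hKt) (show (0 : ℝ) ≤ 3 ^ (ν - 1) by positivity)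
    linarith
  have hK0 : 0 ≤ K := by
    by_contra! hc
    have h7 : K * u t ^ (M + ν) < 0 := mul_neg_of_neg_of_pos hc (by positivity)
    linarith [abs_nonneg (g.eval (u t) - g.eval (v t))]
  obtain ⟨n, rfl⟩ := Nat.exists_eq_succ_of_ne_zero hν
  rw [Nat.succ_sub_one] at h6
  have h8 : u t ^ (M + n.succ) = u t ^ n * (u t ^ M * u t) := by
    rw [← pow_succ, ← pow_add]; congr 1; omega
  rw [h8] at h6
  have h9 : u t ^ n * (|u t - v t| * κ) ≤ u t ^ n * (K * 3 ^ n * (u t ^ M * u t)) := by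
    linarith
  have h10 := le_of_mul_le_mul_left h9 (by positivity)
  refine h10.trans ?_
  rw [mul_assoc K, mul_assoc K]
  refine mul_le_mul_of_nonneg_left ?_ hK0
  refine mul_le_mul ?_ ?_ (by positivity) (by positivity)
  · exact pow_le_pow_right₀ (by norm_num) n.le_succ
  · exact mul_le_of_le_one_right (by positivity) h5''.le

/-- Two curves with the same expansion, parameterized by the same coordinate, have flat
contact. -/
theorem isBigO_sub_of_expansion {A : ℕ → Fin 3 → Polynomial ℝ} {i : Fin 3} {σ : ℝ} {ν : ℕ}
    (hν : ν ≠ 0) {a : ℝ} (ha : 0 < a) {α : Type*} {F : Filter α} [F.NeBot] {x : α → ℝ}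
    {γ δ : α → R3} {u v : α → ℝ} (hut : Tendsto u F (𝓝 0)) (hvt : Tendsto v F (𝓝 0))
    (hu0 : ∀ᶠ t in F, 0 < u t) (hv0 : ∀ᶠ t in F, 0 < v t)
    (hγ : ∀ᶠ t in F, σ * γ t i = x t) (hδ : ∀ᶠ t in F, σ * δ t i = x t)
    (hu : Tendsto (fun t => x t / u t ^ ν) F (𝓝 a))
    (hv : Tendsto (fun t => x t / v t ^ ν) F (𝓝 a))
    (hγA : ∀ N j, (fun t => γ t j - (A N j).eval (u t)) =O[F] fun t => u t ^ N)
    (hδA : ∀ N j, (fun t => δ t j - (A N j).eval (v t)) =O[F] fun t => v t ^ N)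
    (k : ℕ) (j : Fin 3) : (fun t => δ t j - γ t j) =O[F] fun t => x t ^ (k + 1) := by
  -- As `u ^ ν = O(x)`, an error `O(u ^ M)` is an error `O(x ^ (k + 1))`.
  set M := ν * (k + 1) with hMdef
  have hM : M ≠ 0 := mul_ne_zero hν (Nat.succ_ne_zero k)
  have hg : ∀ {γ : α → R3} {u : α → ℝ}, (∀ᶠ t in F, σ * γ t i = x t) →
      (∀ N j, (fun t => γ t j - (A N j).eval (u t)) =O[F] fun t => u t ^ N) →
      (fun t => x t - (Polynomial.C σ * A (M + ν) i).eval (u t)) =O[F]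
        fun t => u t ^ (M + ν) := by
    intro γ u hγ h
    refine ((h (M + ν) i).const_mul_left σ).congr' ?_ EventuallyEq.rfl
    filter_upwards [hγ] with t ht
    rw [← ht]
    simp
    ring
  have huv := isBigO_sub_of_eval hν ha hut hu0 hv0 hu hv (hg hγ hγA) (hg hδ hδA) hM
  have hvO : v =O[F] u := by
    refine IsBigO.of_bound 3 ?_
    filter_upwards [hu0, hv0, eventually_le_three_mul hν ha hv0 hu0 hv hu] with t h1 h2 h3
    rwa [Real.norm_of_nonneg h1.le, Real.norm_of_nonneg h2.le]
  have h1 : (fun t => δ t j - γ t j) =O[F] fun t => u t ^ M := by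
    have e1 := (isBigO_eval_sub (A M j) hut hvt).trans huv
    have e2 := (hδA M j).trans (hvO.pow M)
    exact ((e2.sub (hγA M j)).sub e1).congr_left fun t => by ring
  refine h1.trans ?_
  have h2 : (fun t => u t ^ ν) =O[F] x := by
    refine IsBigO.of_bound (2 / a) ?_
    filter_upwards [hu0, hu.eventually_const_lt (show a / 2 < a by linarith)] with t h1 h3
    rw [lt_div_iff₀ (by positivity)] at h3
    have hx : 0 < x t := lt_trans (by positivity) h3
    rw [Real.norm_of_nonneg (by positivity), Real.norm_of_nonneg hx.le, div_mul_eq_mul_div,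
      le_div_iff₀ ha]
    linarith
  simp_rw [hMdef, pow_mul]
  exact h2.pow (k + 1)

/-! ### Trajectories in a pencil -/

theorem IsIntegralCurve.neg {U : Set R3} {ξ : R3 → R3} {a : ℝ} {c : ℝ → R3}
    (h : IsIntegralCurve U ξ a c) : IsIntegralCurve U (-ξ) a c where
  pos := h.pos
  contDiffOn := h.contDiffOn
  mem := h.mem
  ne_zero := h.ne_zero
  tendsto := h.tendsto
  field_ne_zero t ht := by simpa using h.field_ne_zero t ht
  tangent t ht := by
    obtain ⟨l, hl⟩ := h.tangent t ht
    exact ⟨-l, by simpa using hl⟩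

theorem IsTrajectory.neg {U : Set R3} {ξ : R3 → R3} {Γ : Set R3} (h : IsTrajectory U ξ Γ) :
    IsTrajectory U (-ξ) Γ := by
  obtain ⟨a, c, hc, rfl⟩ := h
  exact ⟨a, c, hc.neg, rfl⟩

theorem IsTrajectory.zero_notMem {U : Set R3} {ξ : R3 → R3} {Γ : Set R3}
    (h : IsTrajectory U ξ Γ) : (0 : R3) ∉ Γ := by
  obtain ⟨a, c, hc, rfl⟩ := h
  rintro ⟨t, ht, h0⟩
  exact hc.ne_zero t ht h0

theorem IsTrajectory.neBot {U : Set R3} {ξ : R3 → R3} {Γ : Set R3}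
    (h : IsTrajectory U ξ Γ) : (𝓝[Γ] (0 : R3)).NeBot := by
  obtain ⟨a, c, hc, rfl⟩ := h
  exact hc.tendsto_image.neBot

theorem IsAsymptotic.isBigO_id {A : ℕ → Fin 3 → Polynomial ℝ} (hA : ∀ N j, (A N j).coeff 0 = 0)
    {S : Set R3} {u : R3 → ℝ} (h : IsAsymptotic A S u) : (fun p : R3 => p) =O[𝓝[S] 0] u := by
  refine isBigO_euclidean fun j => ?_
  have h1 := isBigO_eval_sub (A 1 j) h.tendsto (v := fun _ => 0) tendsto_const_nhds
  have h2 : ∀ p, (A 1 j).eval (u p) - (A 1 j).eval 0 = (A 1 j).eval (u p) := fun p => by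
    rw [← Polynomial.coeff_zero_eq_eval_zero, hA, sub_zero]
  simp only [h2, sub_zero] at h1
  have h3 := h.expand 1 j
  simp only [pow_one] at h3
  exact (h3.add h1).congr_left fun p => by simp

/-- If `x` is increasing with respect to `ξ` along a trajectory near `0`, the chart with first
coordinate `x` is adapted to the trajectory, whose germ is a graph over `x`. -/
theorem IsTrajectory.exists_isParameterization {U : Set R3} (hU : IsOpen U) {ξ : R3 → R3}
    (hξ : AnalyticOnNhd ℝ ξ U) {S : Set R3} (hS : IsTrajectory U ξ S)
    {A : ℕ → Fin 3 → Polynomial ℝ} (hA : ∀ N j, (A N j).coeff 0 = 0) {u : R3 → ℝ}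
    (hu : IsAsymptotic A S u) {i : Fin 3} {σ : ℝ} (hσ : σ ≠ 0) {ν : ℕ}
    (hi : Tendsto (fun p : R3 => p i / u p ^ ν) (𝓝[S] 0) (𝓝 σ))
    (hpos : ∀ᶠ p in 𝓝[S] 0, 0 < σ * ξ p i) :
    (coordChart i σ hσ).IsAdapted ξ S ∧ ∃ (b : ℝ) (e : ℝ → R3),
      (coordChart i σ hσ).IsParameterization U ξ S b e ∧ Tendsto e (𝓝[>] 0) (𝓝[S] 0) := by
  constructor
  · obtain ⟨ε, hε, hball⟩ := Metric.mem_nhdsWithin_iff.1 hpos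
    refine ⟨S ∩ Metric.ball 0 ε, ?_, subset_univ _, fun p hp => ?_⟩
    · filter_upwards [Metric.ball_mem_nhds (0 : R3) hε] with p hp
      exact ⟨fun h => h.1, fun h => ⟨h, hp⟩⟩
    · change 0 < (fderiv ℝ (coordMap i σ) p (ξ p)) 0
      rw [ContinuousLinearMap.fderiv, coordMap_apply_zero]
      exact hball ⟨hp.2, hp.1⟩
  · obtain ⟨a, c, hc, rfl⟩ := hS
    set x : R3 →L[ℝ] ℝ := σ • EuclideanSpace.proj i with hx
    have hxp : ∀ p, x p = σ * p i := fun p => by simp [hx]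
    have hσσ : 0 < σ * σ := mul_self_pos.2 hσ
    have hxt : Tendsto (fun p => x p / u p ^ ν) (𝓝[c '' Ioo 0 a] 0) (𝓝 (σ * σ)) :=
      (hi.const_mul σ).congr fun p => by rw [hxp]; ring
    have hxlow : ∀ᶠ p in 𝓝[c '' Ioo 0 a] 0, u p ^ ν ≤ 2 / (σ * σ) * x p := by
      filter_upwards [hu.pos, hxt.eventually_const_lt (half_lt_self hσσ)] with p h1 h2
      rw [lt_div_iff₀ (by positivity)] at h2
      rw [div_mul_eq_mul_div, le_div_iff₀ hσσ]
      linarith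
    -- From `p = O(u)` and `u ^ ν = O(x)` comes the bound of `‖p‖ ^ ν` by a multiple of `x`, which
    -- supplies the barrier in `exists_parameterization`.
    obtain ⟨K, hK⟩ := ((hu.isBigO_id hA).norm_left.pow ν).bound
    have hev : ∀ᶠ p in 𝓝[c '' Ioo 0 a] 0,
        0 < x p ∧ 0 < x (ξ p) ∧ ‖p‖ ^ ν ≤ |K| * (2 / (σ * σ)) * x p := by
      filter_upwards [hu.pos, hxt.eventually_const_lt hσσ, hpos, hxlow, hK] with p h1 h2 h3 h4 h5
      refine ⟨?_, by rwa [hxp], ?_⟩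
      · exact (div_pos_iff_of_pos_right (by positivity)).1 h2
      · rw [norm_pow, norm_norm, Real.norm_of_nonneg (by positivity)] at h5
        refine h5.trans ((mul_le_mul_of_nonneg_right (le_abs_self K) (by positivity)).trans ?_)
        rw [mul_assoc]
        exact mul_le_mul_of_nonneg_left h4 (abs_nonneg K)
    obtain ⟨b, e, he, hex, heS, hgerm⟩ := hc.exists_parameterization hU
      (fun p hp => (hξ p hp).contDiffAt) x ν _ hev
    refine ⟨b, e, ⟨he, fun t ht => ⟨mem_univ _, ?_⟩, hgerm⟩, ?_⟩
    · exact (coordMap_apply_zero i σ _).trans ((hxp _).symm.trans (hex t ht))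
    · refine tendsto_nhdsWithin_iff.2 ⟨he.tendsto, ?_⟩
      filter_upwards [Ioo_mem_nhdsGT he.pos] with t ht using heS t ht

theorem flatContactIn_coordChart {U : Set R3} (hU : IsOpen U) {ξ : R3 → R3}
    (hξ : AnalyticOnNhd ℝ ξ U) {Γ Δ : Set R3} (hΓ : IsTrajectory U ξ Γ) (hΔ : IsTrajectory U ξ Δ)
    {A : ℕ → Fin 3 → Polynomial ℝ} (hA : ∀ N j, (A N j).coeff 0 = 0) {u v : R3 → ℝ}
    (hu : IsAsymptotic A Γ u) (hv : IsAsymptotic A Δ v) {i : Fin 3} {σ : ℝ} (hσ : σ ≠ 0) {ν : ℕ}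
    (hν : ν ≠ 0) (hui : Tendsto (fun p : R3 => p i / u p ^ ν) (𝓝[Γ] 0) (𝓝 σ))
    (hvi : Tendsto (fun p : R3 => p i / v p ^ ν) (𝓝[Δ] 0) (𝓝 σ))
    (hΓpos : ∀ᶠ p in 𝓝[Γ] 0, 0 < σ * ξ p i) (hΔpos : ∀ᶠ p in 𝓝[Δ] 0, 0 < σ * ξ p i) :
    FlatContactIn (coordChart i σ hσ) U ξ Γ Δ := by
  obtain ⟨hΓa, a, c, hc, hct⟩ := hΓ.exists_isParameterization hU hξ hA hu hσ hui hΓpos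
  obtain ⟨hΔa, b, d, hd, hdt⟩ := hΔ.exists_isParameterization hU hξ hA hv hσ hvi hΔpos
  refine ⟨hΓa, hΔa, a, b, c, d, hc, hd, ?_⟩
  have hcx : ∀ᶠ t in 𝓝[>] (0 : ℝ), σ * c t i = t := by
    filter_upwards [Ioo_mem_nhdsGT hc.1.pos] with t ht
    rw [← coordMap_apply_zero]
    exact (hc.2.1 t ht).2
  have hdx : ∀ᶠ t in 𝓝[>] (0 : ℝ), σ * d t i = t := by
    filter_upwards [Ioo_mem_nhdsGT hd.1.pos] with t ht
    rw [← coordMap_apply_zero]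
    exact (hd.2.1 t ht).2
  have hlim : ∀ {S : Set R3} {u : R3 → ℝ} {c : ℝ → R3}, Tendsto c (𝓝[>] 0) (𝓝[S] 0) →
      (∀ᶠ t in 𝓝[>] (0 : ℝ), σ * c t i = t) →
      Tendsto (fun p : R3 => p i / u p ^ ν) (𝓝[S] 0) (𝓝 σ) →
      Tendsto (fun t => t / u (c t) ^ ν) (𝓝[>] 0) (𝓝 (σ * σ)) := by
    intro S u c hct hcx h
    refine ((h.comp hct).const_mul σ).congr' ?_
    filter_upwards [hcx] with t ht
    simp only [Function.comp]
    rw [← mul_div_assoc, ht]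
  have key := isBigO_sub_of_expansion (A := A) hν (mul_self_pos.2 hσ) (F := 𝓝[>] (0 : ℝ))
    (x := fun t => t) (hu.tendsto.comp hct) (hv.tendsto.comp hdt) (hct.eventually hu.pos)
    (hdt.eventually hv.pos) hcx hdx (hlim hct hcx hui) (hlim hdt hdx hvi)
    (fun N j => (hu.expand N j).comp_tendsto hct) (fun N j => (hv.expand N j).comp_tendsto hdt)
  intro k
  have hO : (fun t => (coordChart i σ hσ).graphMap d t - (coordChart i σ hσ).graphMap c t)
      =O[𝓝[>] (0 : ℝ)] fun t => t ^ (k + 1) := by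
    have h1 : ∀ r : Fin 3, (fun t => coordMap i σ (d t) r - coordMap i σ (c t) r)
        =O[𝓝[>] (0 : ℝ)] fun t => t ^ (k + 1) := fun r =>
      ((key k (Equiv.swap 0 i r)).const_mul_left (if r = 0 then σ else 1)).congr_left fun t => by
        rw [coordMap_apply, coordMap_apply, mul_sub]
    refine isBigO_euclidean fun j => ?_
    fin_cases j
    · exact h1 1
    · exact h1 2
  -- The spare power of `t` absorbs the constant of the estimate.
  have ho : (fun t : ℝ => t ^ (k + 1)) =o[𝓝[>] (0 : ℝ)] fun t : ℝ => t ^ k :=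
    (isLittleO_pow_pow k.lt_succ_self).mono nhdsWithin_le_nhds
  obtain ⟨r, hr, hr'⟩ := mem_nhdsGT_iff_exists_Ioo_subset.1
    ((hO.trans_isLittleO ho).bound one_pos)
  refine ⟨r, hr, fun t ht => ?_⟩
  have := hr' ht
  simp only [mem_ofPred_eq, one_mul, norm_pow, Real.norm_eq_abs] at this
  rwa [abs_of_pos ht.1] at this

theorem analyticAt_coord {ξ : R3 → R3} {p : R3} (h : AnalyticAt ℝ ξ p) (j : Fin 3) :
    AnalyticAt ℝ (fun p => ξ p j) p :=
  ((EuclideanSpace.proj j : R3 →L[ℝ] ℝ).analyticAt _).comp h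

theorem eventually_pos_mul_of_tendsto {S : Set R3} {u f : R3 → ℝ} {m : ℕ} {c r : ℝ}
    (hu : ∀ᶠ p in 𝓝[S] (0 : R3), 0 < u p)
    (h : Tendsto (fun p => f p / u p ^ m) (𝓝[S] 0) (𝓝 c)) (hr : 0 < r * c) :
    ∀ᶠ p in 𝓝[S] 0, 0 < r * f p := by
  filter_upwards [hu, (h.const_mul r).eventually_const_lt hr] with p h1 h2
  rw [← mul_div_assoc] at h2
  exact (div_pos_iff_of_pos_right (by positivity)).1 h2

/-- A coordinate that does not vanish formally along a trajectory cannot have a derivative along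
`ξ` that vanishes formally, unless `ξ` vanishes formally. -/
theorem IsTrajectory.not_isFlat {U : Set R3} (hU : IsOpen U) (h0 : (0 : R3) ∈ U) {ξ : R3 → R3}
    (hξ : AnalyticOnNhd ℝ ξ U) {S : Set R3} (hS : IsTrajectory U ξ S)
    {A : ℕ → Fin 3 → Polynomial ℝ} (hA : ∀ N j, (A N j).coeff 0 = 0) {u : R3 → ℝ}
    (hu : IsAsymptotic A S u) {i j : Fin 3} {σ : ℝ} (hσ : σ ≠ 0) {ν : ℕ}
    (hi : Tendsto (fun p : R3 => p i / u p ^ ν) (𝓝[S] 0) (𝓝 σ))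
    (hj : ¬ IsFlat A fun p => ξ p j) : ¬ IsFlat A fun p => ξ p i := by
  intro hfl
  obtain ⟨m, κ, hκ, hm⟩ := exists_tendsto_of_not_isFlat hA (analyticAt_coord (hξ 0 h0) j) hj
  have hm := hm S u hu
  have hκκ : 0 < κ * κ := mul_self_pos.2 hκ
  have hσσ : 0 < σ * σ := mul_self_pos.2 hσ
  obtain ⟨a, c, hc, rfl⟩ := hS
  -- Here `x * y(ξ) ~ σ ^ 2 * κ ^ 2 * u ^ (ν + m)`, whereas a flat `x(ξ)` is `o(u ^ (ν + m))`.
  refine hc.not_slow hU (fun p hp => (hξ p hp).contDiffAt) (σ • EuclideanSpace.proj i)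
    (κ • EuclideanSpace.proj j) ?_
  have h1 : Tendsto (fun p : R3 => σ * (ξ p i / u p ^ (ν + m))) (𝓝[c '' Ioo 0 a] 0)
      (𝓝 (σ * 0)) := by
    refine Tendsto.const_mul _ (IsLittleO.tendsto_div_nhds_zero ?_)
    refine (hfl.isBigO hA (analyticAt_coord (hξ 0 h0) i) hu (ν + m + 1)).trans_isLittleO ?_
    exact (isLittleO_pow_pow (Nat.lt_succ_self (ν + m))).comp_tendsto hu.tendsto
  have h2 := (hi.const_mul σ).mul (hm.const_mul κ)
  rw [mul_zero] at h1
  have h3 := h2.sub h1.abs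
  rw [abs_zero, sub_zero] at h3
  filter_upwards [hu.pos, eventually_pos_mul_of_tendsto hu.pos hi hσσ,
    eventually_pos_mul_of_tendsto hu.pos hm hκκ,
    h3.eventually_const_lt (mul_pos hσσ hκκ)] with p hp hp1 hp2 hp3
  refine ⟨by simpa using hp1, by simpa using hp2, ?_⟩
  have e1 : σ * (p i / u p ^ ν) * (κ * (ξ p j / u p ^ m)) - |σ * (ξ p i / u p ^ (ν + m))| =
      (σ * p i * (κ * ξ p j) - |σ * ξ p i|) / u p ^ (ν + m) := by
    rw [← mul_div_assoc σ (ξ p i), abs_div, abs_of_pos (show 0 < u p ^ (ν + m) by positivity),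
      pow_add]
    field_simp
  rw [e1] at hp3
  have := (div_pos_iff_of_pos_right (show 0 < u p ^ (ν + m) by positivity)).1 hp3
  change |σ * ξ p i| ≤ σ * p i * (κ * ξ p j)
  linarith

end FlatContactPencil
end

/-! ### Flat contact in an integral pencil. -/

theorem mainTheorem10
    (U : Set FlatContactPencil.R3) (hU : IsOpen U) (h0 : (0 : FlatContactPencil.R3) ∈ U)
    (ξ : FlatContactPencil.R3 → FlatContactPencil.R3)
    (hξ : AnalyticOnNhd ℝ ξ U) (hξ0 : ξ 0 = 0)
    (C : FlatContactPencil.FormalCurve)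
    (hC : FlatContactPencil.IsNonDegenerate ξ C)
    (Γ Δ : Set FlatContactPencil.R3)
    (hΓ : Γ ∈ FlatContactPencil.integralPencil U ξ C)
    (hΔ : Δ ∈ FlatContactPencil.integralPencil U ξ C) :
    ∃ B : FlatContactPencil.Chart, B.IsAnalytic ∧
      (FlatContactPencil.FlatContactIn B U ξ Γ Δ ∨
        FlatContactPencil.FlatContactIn B U (-ξ) Γ Δ) := by
  open FlatContactPencil in
  obtain ⟨hΓ, q, hq, hqΓ⟩ := hΓ
  obtain ⟨hΔ, q', hq', hqΔ⟩ := hΔ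
  obtain rfl := hq.unique hq'
  obtain ⟨A, hA, ⟨V, hV, hCV⟩, hexp⟩ := exists_expansion C q hq
  obtain ⟨u, hu⟩ := hexp Γ hΓ.zero_notMem hqΓ
  obtain ⟨v, hv⟩ := hexp Δ hΔ.zero_notMem hqΔ
  obtain ⟨i, hi⟩ : ∃ i : Fin 3, ¬ IsFlat A fun p => p i := by
    by_contra! hc
    exact C.ne_zero (funext fun i => (hc i).coord_eq_zero hV fun N => hCV N i)
  obtain ⟨ν, σ, hσ, hσt⟩ :=
    exists_tendsto_of_not_isFlat hA (analyticAt_coord analyticAt_id i) hi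
  have hν : ν ≠ 0 := by
    rintro rfl
    have := hΓ.neBot
    have h1 := hσt Γ u hu
    simp only [pow_zero, div_one] at h1
    refine hσ (tendsto_nhds_unique h1 ?_)
    exact ((EuclideanSpace.proj i : R3 →L[ℝ] ℝ).continuous.tendsto' 0 0 (map_zero _)).mono_left
      nhdsWithin_le_nhds
  obtain ⟨j, hj⟩ := hC
  have hj' : ¬ IsFlat A fun p => ξ p j := fun hc =>
    hj (hc.comp_eq_zero hA (analyticAt_coord (hξ 0 h0) j) C hV hCV)
  -- The dynamics of `Γ` alone is used, but the conclusion concerns only `A`, so it also governs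
  -- `Δ`.
  have hξi := hΓ.not_isFlat hU h0 hξ hA hu hσ (hσt Γ u hu) hj'
  obtain ⟨m, κ, hκ, hκt⟩ :=
    exists_tendsto_of_not_isFlat hA (analyticAt_coord (hξ 0 h0) i) hξi
  refine ⟨coordChart i σ hσ, coordChart_isAnalytic i σ hσ, ?_⟩
  -- The sign of `σ * κ` is that of `dx(ξ)` near `0` on both trajectories; if it is negative, they
  -- run towards `0` and `ξ` is replaced by `-ξ`.
  rcases (mul_ne_zero hσ hκ).lt_or_gt with hneg | hpos
  · right
    have hneg' : 0 < -σ * κ := by linarith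
    refine flatContactIn_coordChart hU hξ.neg hΓ.neg hΔ.neg hA hu hv hσ hν (hσt Γ u hu)
      (hσt Δ v hv) ?_ ?_
    · simpa using eventually_pos_mul_of_tendsto hu.pos (hκt Γ u hu) hneg'
    · simpa using eventually_pos_mul_of_tendsto hv.pos (hκt Δ v hv) hneg'
  · left
    exact flatContactIn_coordChart hU hξ hΓ hΔ hA hu hv hσ hν (hσt Γ u hu) (hσt Δ v hv)
      (eventually_pos_mul_of_tendsto hu.pos (hκt Γ u hu) hpos)
      (eventually_pos_mul_of_tendsto hv.pos (hκt Δ v hv) hpos)
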